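/- **Theorem (General LOCC inequality).** Let $A=A_1\ldots A_n$ and $A'=A'_1\ldots A'_n$ be $n$-partite quantum systems with separable, possibly infinite-dimensional local Hilbert spaces, each with a fixed orthonormal basis; complex conjugation $^*$ and (partial) transposition are taken in the product bases. Let $\mathcal E=\{\mathrm d\mu(\alpha),\psi_\alpha\}$ be an ensemble of pure states on $A$: $\mu$ is a probability measure (discrete or not), $\alpha\mapsto|\psi_\alpha\rangle\in\mathcal H_A$ is a measurable family of unit vectors, and $\psi_\alpha=|\psi_\alpha\rangle\langle\psi_\alpha|$. Let $U:\mathcal H_A\to\mathcal H_{A'}$ be an isometry and $\psi'_\alpha=U\psi_\alpha U^\dagger$. Put $$F_{\mathcal C}(\mathcal E,U)=\sup_{\Lambda\in\mathcal C}\int \mathrm d\mu(\alpha)\,\mathrm{Tr}[\Lambda(\psi_\alpha)\psi'_\alpha],\qquad R_{AA'}=\int \mathrm d\mu(\alpha)\,(\psi_\alpha^*)_A\otimes(\psi'_\alpha)_{A'},\qquad R_A=\mathrm{Tr}_{A'}R_{AA'},$$ where $\mathcal C$ is either the set $\mathrm{LOCC}(A\to A')$ of channels that are realised by local operations and classical communication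 or are pointwise limits of such channels, or the set $\mathrm{PPT}(A\to A')$ of channels whose Choi operator $\sum_{a,b}|a\rangle\langle b|\otimes\Lambda(|a\rangle\langle b|)$ has positive semidefinite partial transposes $\Gamma_J$ (tested on vectors of finite support) for all $J\subseteq[n]=\{1,\dots,n\}$. Here $\Gamma_J$ is the partial transposition over all $A_j,A'_j$ with $j\in J$. Let $d_{\max}(X\|Y)=\inf\{\lambda>0: X\le\lambda Y\}\in[0,\infty]$ and, for an operator $L$ on $AA'$, let $H_{\min}(A'|A)_L=-\log\inf_{\xi_A}d_{\max}(L\,\|\,\xi_A\otimes\mathbb 1_{A'})$, the infimum being over density operators $\xi_A$ on $A$, with $\log 0=-\infty$ and $\log\infty=\infty$. 1. $F_{\mathrm{LOCC}}(\mathcal E,U)\le F_{\mathrm{PPT}}(\mathcal E,U)$, and both are at most $$\min_{J\subseteq[n]}\exp\left[-H_{\min}(A'|A)_{R^{\Gamma_J}}\right]=\min_{J\subseteq[n]}\inf_{\xi_A}d_{\max}\left(R_{AA'}^{\Gamma_J}\,\big\|\,\xi_A\otimes\mathbb 1_{A'}\right)=\min_{J\subseteq[n]}\inf\left\{\kappa\ge0:\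 R_{AA'}^{\Gamma_J}\le\kappa\,\xi_A\otimes\mathbb 1_{A'}\text{ for some state }\xi_A\right\}.$$ 2. The value at $J$ of the quantity $\exp[-H_{\min}(A'|A)_{R^{\Gamma_J}}]$ equals that at $[n]\setminus J$, and its value at $J=\emptyset$ is at least $1$. Hence one may restrict to $1\le|J|\le\lfloor n/2\rfloor$ without loss: the minimum over all $J$ and the minimum over these $J$ (which is $+\infty$ if there are none) agree after taking the minimum of each with the trivial bound $1$. 3. If $|\psi_\alpha\rangle=\bigotimes_{j=1}^n|\psi_{\alpha,j}\rangle$ is a product of unit vectors for every $\alpha$, then $F_{\mathrm{LOCC}}(\mathcal E,U)$ and $F_{\mathrm{PPT}}(\mathcal E,U)$ are at most $$\min_{J\subseteq[n]}d_{\max}\left(R_{AA'}^{\Gamma_J}\,\big\|\,R_A^{\Gamma_J}\otimes\mathbb 1_{A'}\right)\le 1 .$$ In fact $d_{\max}(R_{AA'}^{\Gamma_J}\|R_A^{\Gamma_J}\otimes\mathbb 1_{A'})\le1$ for every $J$, the value at $J$ equals that at $[n]\setminus J$, and for $n\ge2$ the minimum is unchanged if restricted to $1\le|J|\le\lfloor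 n/2\rfloor$. -/

import Mathlib

open scoped ENNReal InnerProductSpace ComplexOrder Topology

noncomputable section

namespace LOCCBound

/-! ### Hilbert spaces with a chosen orthonormal basis

A separable Hilbert space with a chosen orthonormal basis indexed by a countable type `ι` is, in
coordinates, the space `ℓ²(ι)`.  The Hilbert tensor product of `ℓ²(ι)` and `ℓ²(κ)` is `ℓ²(ι × κ)`,
and that of the spaces `ℓ²(I j)`, `j : Fin n`, is `ℓ²(∀ j, I j)`. -/

/-- The Hilbert space with orthonormal basis indexed by `ι`. -/
abbrev Hilb (ι : Type) : Type := lp (fun _ : ι => ℂ) 2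

/-- Bounded operators. -/
abbrev Op (ι : Type) : Type := Hilb ι →L[ℂ] Hilb ι

open Classical in
/-- The basis vector with label `a`. -/
def ket {ι : Type} (a : ι) : Hilb ι := lp.single 2 a (1 : ℂ)

/-- The matrix of a bounded operator in the chosen basis. -/
def entry {ι : Type} (X : Op ι) : Matrix ι ι ℂ :=
  Matrix.of fun a b => ⟪ket a, X (ket b)⟫_ℂ

theorem inner_ket {ι : Type} (a : ι) (x : Hilb ι) : ⟪ket a, x⟫_ℂ = x a := by
  classical
  unfold ket
  have := lp.inner_single_left (𝕜 := ℂ) (G := fun _ : ι => ℂ) a (1 : ℂ) x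
  simp only [RCLike.inner_apply, map_one, mul_one] at this
  convert this

theorem ket_apply {ι : Type} [DecidableEq ι] (a b : ι) :
    (ket a : Hilb ι) b = if b = a then 1 else 0 := by
  simp [ket, Pi.single_apply]

theorem hasSum_normSq {ι : Type} (x : Hilb ι) : HasSum (fun a => ‖x a‖ ^ 2) (‖x‖ ^ 2) := by
  have h := lp.hasSum_norm (p := 2) (by norm_num) x
  simpa using h

theorem memHilb {ι : Type} {f : ι → ℂ} (h : Summable fun a => ‖f a‖ ^ 2) :
    Memℓp (E := fun _ : ι => ℂ) f 2 := by
  apply memℓp_gen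
  simpa using h

/-- A linear map into functions that is bounded in the `ℓ²` sense, as a bounded operator. -/
def mkOp {ι κ : Type} (f : Hilb ι →ₗ[ℂ] (κ → ℂ)) (C : ℝ) (hC : 0 ≤ C)
    (h : ∀ x, ∀ s : Finset κ, ∑ a ∈ s, ‖f x a‖ ^ 2 ≤ (C * ‖x‖) ^ 2) : Hilb ι →L[ℂ] Hilb κ :=
  LinearMap.mkContinuous
    { toFun := fun x => ⟨f x, memHilb (summable_of_sum_le (fun _ => by positivity) (h x))⟩
      map_add' := fun x y => Subtype.ext (map_add f x y)
      map_smul' := fun c x => Subtype.ext (map_smul f c x) } C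
    (fun x => by
      refine lp.norm_le_of_forall_sum_le (p := 2) (by norm_num) (by positivity) fun s => ?_
      simpa using h x s)

/-! ### Hilbert--Schmidt operators -/

/-- A matrix is Hilbert--Schmidt if its entries are square summable. -/
def IsHSMatrix {ι : Type} (M : Matrix ι ι ℂ) : Prop :=
  Summable fun p : ι × ι => ‖M p.1 p.2‖ ^ 2

def hsRow {ι : Type} (M : Matrix ι ι ℂ) (hM : IsHSMatrix M) (a : ι) : Hilb ι :=
  ⟨fun b => star (M a b), memHilb (by
    simpa [Function.comp_def] using
      Summable.comp_injective (i := fun b => (a, b)) hM (fun b b' h => by simpa using h))⟩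

theorem sum_hsRow {ι : Type} (M : Matrix ι ι ℂ) (hM : IsHSMatrix M) (s : Finset ι) :
    ∑ a ∈ s, ‖hsRow M hM a‖ ^ 2 ≤ ∑' p : ι × ι, ‖M p.1 p.2‖ ^ 2 := by
  have h1 : ∀ a, ∑' b, ‖M a b‖ ^ 2 = ‖hsRow M hM a‖ ^ 2 := fun a => by
    have := (hasSum_normSq (hsRow M hM a)).tsum_eq
    simpa [hsRow] using this
  have h2 := hM.prod
  rw [hM.tsum_prod]
  simp only [h1] at h2 ⊢
  exact h2.sum_le_tsum s fun _ _ => by positivity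

/-- The bounded operator with Hilbert--Schmidt matrix `M`. -/
def hsOp {ι : Type} (M : Matrix ι ι ℂ) (hM : IsHSMatrix M) : Op ι :=
  mkOp (LinearMap.pi fun a => innerₛₗ ℂ (hsRow M hM a))
    (Real.sqrt (∑' p : ι × ι, ‖M p.1 p.2‖ ^ 2)) (Real.sqrt_nonneg _) (by
      intro x s
      rw [mul_pow, Real.sq_sqrt (tsum_nonneg fun _ => by positivity)]
      refine le_trans ?_ (mul_le_mul_of_nonneg_right (sum_hsRow M hM s) (by positivity))
      rw [Finset.sum_mul]
      refine Finset.sum_le_sum fun a _ => ?_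
      rw [← mul_pow]
      exact pow_le_pow_left₀ (norm_nonneg _) (norm_inner_le_norm (𝕜 := ℂ) (hsRow M hM a) x) 2)

theorem entry_hsOp {ι : Type} (M : Matrix ι ι ℂ) (hM : IsHSMatrix M) : entry (hsOp M hM) = M := by
  classical
  ext a b
  change ⟪ket a, hsOp M hM (ket b)⟫_ℂ = _
  rw [inner_ket]
  change ⟪hsRow M hM a, ket b⟫_ℂ = _
  rw [← inner_conj_symm, inner_ket]
  simp [hsRow]

open Classical in
/-- The operator with matrix `M`; only meant for Hilbert--Schmidt matrices. -/
def ofMatrix {ι : Type} (M : Matrix ι ι ℂ) : Op ι :=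
  if hM : IsHSMatrix M then hsOp M hM else 0

/-! ### Tensor products -/

/-- The vector `u ⊗ w`. -/
def tensorVec {ι κ : Type} (u : Hilb ι) (w : Hilb κ) : Hilb (ι × κ) :=
  ⟨fun p => u p.1 * w p.2, memHilb (by
    have := (hasSum_normSq u).summable.mul_of_nonneg (hasSum_normSq w).summable
      (fun _ => by positivity) (fun _ => by positivity)
    simpa [mul_pow] using this)⟩

/-- The component `(1 ⊗ ⟨c|) x` of a vector `x`. -/
def slice {ι κ : Type} (c : κ) : Hilb (ι × κ) →ₗ[ℂ] Hilb ι where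
  toFun x := ⟨fun a => x (a, c), memHilb ((hasSum_normSq x).summable.comp_injective
    (i := fun a => (a, c)) (fun a b h => by simpa using h))⟩
  map_add' _ _ := rfl
  map_smul' _ _ := rfl

theorem sum_slice {ι κ : Type} (x : Hilb (ι × κ)) (s : Finset κ) :
    ∑ c ∈ s, ‖slice c x‖ ^ 2 ≤ ‖x‖ ^ 2 := by
  have h := (hasSum_normSq x).summable
  have h0 := (Equiv.prodComm κ ι).summable_iff.2 h
  have h1 : ∀ c, ∑' a, ‖x (a, c)‖ ^ 2 = ‖slice c x‖ ^ 2 := fun c =>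
    (hasSum_normSq (slice c x)).tsum_eq
  have h2 := h0.prod
  have h3 := ((Equiv.prodComm κ ι).tsum_eq (fun p => ‖x p‖ ^ 2)).symm.trans h0.tsum_prod
  rw [(hasSum_normSq x).tsum_eq] at h3
  simp only [Function.comp_apply, Equiv.prodComm_apply, Prod.swap_prod_mk, h1] at h2 h3
  rw [h3]
  exact h2.sum_le_tsum s fun _ _ => by positivity

/-- The operator `X ⊗ 1`. -/
def tensorOne {ι : Type} (κ : Type) (X : Op ι) : Op (ι × κ) :=
  mkOp (LinearMap.pi fun p : ι × κ =>
      (innerₛₗ ℂ (ket p.1)).comp (X.toLinearMap.comp (slice p.2)))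
    ‖X‖ (norm_nonneg _) (by
      classical
      intro x s
      have hsub : s ⊆ s.image Prod.fst ×ˢ s.image Prod.snd := fun p hp =>
        Finset.mem_product.2 ⟨Finset.mem_image_of_mem _ hp, Finset.mem_image_of_mem _ hp⟩
      refine (Finset.sum_le_sum_of_subset_of_nonneg hsub fun _ _ _ => by positivity).trans ?_
      rw [Finset.sum_product_right, mul_pow]
      refine le_trans ?_ (mul_le_mul_of_nonneg_left (sum_slice x (s.image Prod.snd))
        (by positivity))
      rw [Finset.mul_sum]
      refine Finset.sum_le_sum fun c _ => ?_
      rw [← mul_pow]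
      refine le_trans ?_ (pow_le_pow_left₀ (norm_nonneg _) (X.le_opNorm (slice c x)) 2)
      have hs := hasSum_normSq (X (slice c x))
      have := hs.summable.sum_le_tsum (s.image Prod.fst) fun _ _ => by positivity
      rw [hs.tsum_eq] at this
      simpa [inner_ket] using this)

theorem entry_tensorOne {ι κ : Type} [DecidableEq κ] (X : Op ι) (a b : ι) (c d : κ) :
    entry (tensorOne κ X) (a, c) (b, d) = if c = d then entry X a b else 0 := by
  classical
  change ⟪ket (a, c), tensorOne κ X (ket (b, d))⟫_ℂ = _
  rw [inner_ket]
  change ⟪ket a, X (slice c (ket (b, d)))⟫_ℂ = _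
  have h : slice c (ket (b, d) : Hilb (ι × κ)) = if c = d then ket b else 0 := by
    ext a'
    change (ket (b, d) : Hilb (ι × κ)) (a', c) = _
    rw [ket_apply]
    split_ifs <;> simp_all [ket_apply]
  rw [h]
  split_ifs
  · rfl
  · simp

/-- `Y` is the operator `⨂ j, X j` on an `n`-partite system. -/
def IsTensor {n : ℕ} {I : Fin n → Type} (X : ∀ j, Op (I j)) (Y : Op (∀ j, I j)) : Prop :=
  ∀ a b, entry Y a b = ∏ j, entry (X j) (a j) (b j)

/-! ### Trace class operators and states -/

/-- The trace; meant for trace class operators, for which the series converges absolutely. -/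
def tr {ι : Type} (X : Op ι) : ℂ := ∑' a, entry X a a

/-- The trace class operators: the linear span of the positive operators of finite trace. -/
def traceClass (ι : Type) : Submodule ℂ (Op ι) :=
  Submodule.span ℂ {P | P.IsPositive ∧ Summable fun a => entry P a a}

abbrev TC (ι : Type) : Type := traceClass ι

/-- Density operators. -/
def IsState {ι : Type} (ρ : Op ι) : Prop :=
  ρ.IsPositive ∧ HasSum (fun a => entry ρ a a) 1

theorem rankOne_self_mem {ι : Type} (u : Hilb ι) :
    InnerProductSpace.rankOne ℂ u u ∈ traceClass ι := by
  refine Submodule.subset_span ⟨InnerProductSpace.isPositive_rankOne_self u, ?_⟩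
  have h := (hasSum_normSq u).summable
  have h' : Summable fun a => ((‖u a‖ ^ 2 : ℝ) : ℂ) := Complex.ofRealCLM.summable h
  refine h'.congr fun a => ?_
  change _ = ⟪ket a, _⟫_ℂ
  rw [InnerProductSpace.inner_right_rankOne_apply, inner_ket, ← inner_conj_symm u, inner_ket,
    Complex.mul_conj, Complex.normSq_eq_norm_sq]

theorem rankOne_mem {ι : Type} (u w : Hilb ι) :
    InnerProductSpace.rankOne ℂ u w ∈ traceClass ι := by
  have key : InnerProductSpace.rankOne ℂ u w = (1 / 4 : ℂ) •
      (InnerProductSpace.rankOne ℂ (u + w) (u + w) - InnerProductSpace.rankOne ℂ (u - w) (u - w)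
        + Complex.I • InnerProductSpace.rankOne ℂ (u + Complex.I • w) (u + Complex.I • w)
        - Complex.I • InnerProductSpace.rankOne ℂ (u - Complex.I • w) (u - Complex.I • w)) := by
    refine ContinuousLinearMap.ext fun z => ?_
    simp only [smul_apply, add_apply, sub_apply,
      InnerProductSpace.rankOne_apply, inner_add_left,
      inner_sub_left, inner_smul_left, Complex.conj_I]
    match_scalars
    · linear_combination (1 / 2 * ⟪w, z⟫_ℂ) * Complex.I_sq
    · linear_combination (-(1 / 2) * ⟪u, z⟫_ℂ) * Complex.I_sq
  rw [key]
  refine Submodule.smul_mem _ _ (Submodule.sub_mem _ (Submodule.add_mem _ (Submodule.sub_mem _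
    (rankOne_self_mem _) (rankOne_self_mem _)) (Submodule.smul_mem _ _ (rankOne_self_mem _)))
    (Submodule.smul_mem _ _ (rankOne_self_mem _)))

/-- The trace class operator `|u⟩⟨w|`. -/
def ketbra {ι : Type} (u w : Hilb ι) : TC ι := ⟨InnerProductSpace.rankOne ℂ u w, rankOne_mem u w⟩

/-! ### Channels -/

/-- A matrix of operators is positive as an operator on `ℂᵐ ⊗ H`. -/
def BlockPositive {ι : Type} {m : ℕ} (X : Fin m → Fin m → Op ι) : Prop :=
  ∀ v : Fin m → Hilb ι, 0 ≤ ∑ i, ∑ j, ⟪v i, X i j (v j)⟫_ℂ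

/-- Complete positivity: `id ⊗ Φ` is positive for every finite-dimensional ancilla. -/
def IsCP {ι κ : Type} (Φ : TC ι →ₗ[ℂ] TC κ) : Prop :=
  ∀ (m : ℕ) (X : Fin m → Fin m → TC ι),
    BlockPositive (fun i j => (X i j : Op ι)) → BlockPositive (fun i j => (Φ (X i j) : Op κ))

def IsTP {ι κ : Type} (Φ : TC ι →ₗ[ℂ] TC κ) : Prop :=
  ∀ X : TC ι, tr (Φ X : Op κ) = tr (X : Op ι)

/-- Quantum channels: completely positive trace preserving maps. -/
def IsChannel {ι κ : Type} (Φ : TC ι →ₗ[ℂ] TC κ) : Prop := IsCP Φ ∧ IsTP Φ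

/-! ### LOCC channels -/

/-- `G` acts on product operators as the tensor product of the local maps `L j`.  A completely
positive `G` is determined by this property. -/
def IsProductMap {n : ℕ} {I M : Fin n → Type} (L : ∀ j, TC (I j) →ₗ[ℂ] TC (M j))
    (G : TC (∀ j, I j) →ₗ[ℂ] TC (∀ j, M j)) : Prop :=
  ∀ (X : ∀ j, TC (I j)) (Y : TC (∀ j, I j)),
    IsTensor (fun j => (X j : Op (I j))) (Y : Op (∀ j, I j)) →
      IsTensor (fun j => (L j (X j) : Op (M j))) (G Y : Op (∀ j, M j))

/-- Channels realised by a protocol of local operations and classical communication in which every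
run ends after finitely many rounds.  In a round, party `k` performs a local instrument with
outcomes `x : ℕ` (some of which may never occur), broadcasts the outcome, and the other parties
apply local channels that may depend on `x`; the intermediate local systems `M x j` are arbitrary.
The rest of the protocol may depend on `x`.  At the end the parties apply local channels. -/
inductive LOCCProtocol {n : ℕ} {I' : Fin n → Type} :
    ∀ {I : Fin n → Type}, (TC (∀ j, I j) →ₗ[ℂ] TC (∀ j, I' j)) → Prop
  | final {I : Fin n → Type} (L : ∀ j, TC (I j) →ₗ[ℂ] TC (I' j)) (hL : ∀ j, IsChannel (L j))
      (Λ : TC (∀ j, I j) →ₗ[ℂ] TC (∀ j, I' j)) (hΛ : IsChannel Λ) (hprod : IsProductMap L Λ) :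
      LOCCProtocol Λ
  | round {I : Fin n → Type} (k : Fin n) (M : ℕ → Fin n → Type)
      (hM : ∀ x j, Countable (M x j))
      (L : ∀ x j, TC (I j) →ₗ[ℂ] TC (M x j)) (hCP : ∀ x j, IsCP (L x j))
      (hTP : ∀ x j, j ≠ k → IsTP (L x j))
      (hinstr : ∀ X : TC (I k),
        HasSum (fun x => tr (L x k X : Op (M x k))) (tr (X : Op (I k))))
      (G : ∀ x, TC (∀ j, I j) →ₗ[ℂ] TC (∀ j, M x j)) (hG : ∀ x, IsCP (G x))
      (hprod : ∀ x, IsProductMap (L x) (G x))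
      (Φ : ∀ x, TC (∀ j, M x j) →ₗ[ℂ] TC (∀ j, I' j)) (hΦ : ∀ x, LOCCProtocol (Φ x))
      (Λ : TC (∀ j, I j) →ₗ[ℂ] TC (∀ j, I' j)) (hΛ : IsChannel Λ)
      (hsum : ∀ (X : TC (∀ j, I j)) (u w : Hilb (∀ j, I' j)),
        HasSum (fun x => ⟪u, (Φ x (G x X) : Op (∀ j, I' j)) w⟫_ℂ)
          ⟪u, (Λ X : Op (∀ j, I' j)) w⟫_ℂ) :
      LOCCProtocol Λ

/-- LOCC channels: the channels that are limits of LOCC protocols, pointwise on trace class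
operators.  (For states, weak convergence to a state and convergence in trace norm coincide.)
Limits account for protocols with infinitely many rounds or with continuous messages. -/
def IsLOCC {n : ℕ} {I I' : Fin n → Type} (Λ : TC (∀ j, I j) →ₗ[ℂ] TC (∀ j, I' j)) : Prop :=
  IsChannel Λ ∧ ∃ S : ℕ → (TC (∀ j, I j) →ₗ[ℂ] TC (∀ j, I' j)), (∀ r, LOCCProtocol (S r)) ∧
    ∀ (X : TC (∀ j, I j)) (u w : Hilb (∀ j, I' j)),
      Filter.Tendsto (fun r => ⟪u, (S r X : Op (∀ j, I' j)) w⟫_ℂ) Filter.atTop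
        (𝓝 ⟪u, (Λ X : Op (∀ j, I' j)) w⟫_ℂ)

/-! ### Partial transposition -/

/-- Partial transposition of a matrix on an `n`-partite system, over the parties in `J`. -/
def ptMatrix {n : ℕ} {I : Fin n → Type} (J : Finset (Fin n))
    (M : Matrix (∀ j, I j) (∀ j, I j) ℂ) : Matrix (∀ j, I j) (∀ j, I j) ℂ :=
  Matrix.of fun a b => M (J.piecewise b a) (J.piecewise a b)

/-- Partial transposition over the systems `A_j` and `A'_j`, `j ∈ J`, of a matrix on `A A'`. -/
def ptMatrix₂ {n : ℕ} {I I' : Fin n → Type} (J : Finset (Fin n))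
    (M : Matrix ((∀ j, I j) × (∀ j, I' j)) ((∀ j, I j) × (∀ j, I' j)) ℂ) :
    Matrix ((∀ j, I j) × (∀ j, I' j)) ((∀ j, I j) × (∀ j, I' j)) ℂ :=
  Matrix.of fun p q => M (J.piecewise q.1 p.1, J.piecewise q.2 p.2)
    (J.piecewise p.1 q.1, J.piecewise p.2 q.2)

/-- The partial transpose of a Hilbert--Schmidt operator on `A`. -/
def partialTranspose {n : ℕ} {I : Fin n → Type} (J : Finset (Fin n)) (X : Op (∀ j, I j)) :
    Op (∀ j, I j) := ofMatrix (ptMatrix J (entry X))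

/-- The partial transpose of a Hilbert--Schmidt operator on `A A'`. -/
def partialTranspose₂ {n : ℕ} {I I' : Fin n → Type} (J : Finset (Fin n))
    (X : Op ((∀ j, I j) × (∀ j, I' j))) : Op ((∀ j, I j) × (∀ j, I' j)) :=
  ofMatrix (ptMatrix₂ J (entry X))

/-- The partial trace over the second factor, for trace class operators. -/
def partialTrace {ι κ : Type} (X : Op (ι × κ)) : Op ι :=
  ofMatrix (Matrix.of fun a b => ∑' c, entry X (a, c) (b, c))

/-! ### PPT channels -/

/-- The matrix of the unnormalised Choi operator `∑ a b, |a⟩⟨b| ⊗ Λ(|a⟩⟨b|)`. -/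
def choi {ι κ : Type} (Λ : TC ι →ₗ[ℂ] TC κ) : Matrix (ι × κ) (ι × κ) ℂ :=
  Matrix.of fun p q => entry (Λ (ketbra (ket p.1) (ket q.1)) : Op κ) p.2 q.2

/-- PPT channels: every partial transpose of the Choi matrix is positive semidefinite.  On infinite
index types, `Matrix.PosSemidef` tests the quadratic form on vectors of finite support, that is, it
tests all finite truncations of the Choi operator. -/
def IsPPT {n : ℕ} {I I' : Fin n → Type} (Λ : TC (∀ j, I j) →ₗ[ℂ] TC (∀ j, I' j)) : Prop :=
  IsChannel Λ ∧ ∀ J : Finset (Fin n), (ptMatrix₂ J (choi Λ)).PosSemidef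

/-! ### Max-relative entropy and conditional min-entropy -/

/-- `d_max(X‖Y) = inf {λ > 0 : X ≤ λ Y}`, with value `∞` if there is no such `λ`. -/
def dmax {ι : Type} (X Y : Op ι) : ℝ≥0∞ :=
  ⨅ (l : ℝ) (_ : 0 < l ∧ X ≤ (l : ℂ) • Y), ENNReal.ofReal l

/-- The conditional min-entropy `H_min(A'|A)` of an operator on `A A'`. -/
def Hmin {ι κ : Type} (X : Op (ι × κ)) : EReal :=
  -ENNReal.log (⨅ (ξ : Op ι) (_ : IsState ξ), dmax X (tensorOne κ ξ))

/-! ### Ensembles and simulation fidelities -/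

/-- An ensemble of pure states, given by a random unit vector. -/
structure Ensemble (Ω : Type*) [MeasurableSpace Ω] (ι : Type) where
  μ : MeasureTheory.Measure Ω
  isProb : MeasureTheory.IsProbabilityMeasure μ
  ψ : Ω → Hilb ι
  meas : MeasureTheory.AEStronglyMeasurable ψ μ
  norm_one : ∀ α, ‖ψ α‖ = 1

/-- `∫ dμ(α) Tr[Λ(ψ_α) ψ'_α]` with `ψ'_α = U ψ_α U†`. -/
def avgFidelity {Ω : Type*} [MeasurableSpace Ω] {ι κ : Type} (E : Ensemble Ω ι)
    (U : Hilb ι →ₗᵢ[ℂ] Hilb κ) (Λ : TC ι →ₗ[ℂ] TC κ) : ℝ≥0∞ :=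
  ∫⁻ α, ENNReal.ofReal
    (tr ((Λ (ketbra (E.ψ α) (E.ψ α)) : Op κ) ∘L (ketbra (U (E.ψ α)) (U (E.ψ α)) : Op κ))).re ∂E.μ

/-- The LOCC simulation fidelity. -/
def loccFidelity {Ω : Type*} [MeasurableSpace Ω] {n : ℕ} {I I' : Fin n → Type}
    (E : Ensemble Ω (∀ j, I j)) (U : Hilb (∀ j, I j) →ₗᵢ[ℂ] Hilb (∀ j, I' j)) : ℝ≥0∞ :=
  ⨆ (Λ : TC (∀ j, I j) →ₗ[ℂ] TC (∀ j, I' j)) (_ : IsLOCC Λ), avgFidelity E U Λ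

/-- The PPT simulation fidelity. -/
def pptFidelity {Ω : Type*} [MeasurableSpace Ω] {n : ℕ} {I I' : Fin n → Type}
    (E : Ensemble Ω (∀ j, I j)) (U : Hilb (∀ j, I j) →ₗᵢ[ℂ] Hilb (∀ j, I' j)) : ℝ≥0∞ :=
  ⨆ (Λ : TC (∀ j, I j) →ₗ[ℂ] TC (∀ j, I' j)) (_ : IsPPT Λ), avgFidelity E U Λ

/-- `R = ∫ dμ(α) ψ_α^* ⊗ ψ'_α`, where `star` is the complex conjugate in the chosen basis. -/
def Rop {Ω : Type*} [MeasurableSpace Ω] {ι κ : Type} (E : Ensemble Ω ι)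
    (U : Hilb ι →ₗᵢ[ℂ] Hilb κ) : Op (ι × κ) :=
  ∫ α, InnerProductSpace.rankOne ℂ (tensorVec (star (E.ψ α)) (U (E.ψ α)))
    (tensorVec (star (E.ψ α)) (U (E.ψ α))) ∂E.μ

/-- Every vector of the ensemble is a product vector. -/
def Ensemble.IsProduct {Ω : Type*} [MeasurableSpace Ω] {n : ℕ} {I : Fin n → Type}
    (E : Ensemble Ω (∀ j, I j)) : Prop :=
  ∀ α, ∃ φ : ∀ j, Hilb (I j), (∀ j, ‖φ j‖ = 1) ∧ ∀ a, E.ψ α a = ∏ j, φ j (a j)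

/-- `exp[-H_min(A'|A)]` of the partial transpose of `R` over `J`. -/
def minEntropyBound {Ω : Type*} [MeasurableSpace Ω] {n : ℕ} {I I' : Fin n → Type}
    (E : Ensemble Ω (∀ j, I j)) (U : Hilb (∀ j, I j) →ₗᵢ[ℂ] Hilb (∀ j, I' j))
    (J : Finset (Fin n)) : ℝ≥0∞ :=
  EReal.exp (-Hmin (partialTranspose₂ J (Rop E U)))

/-- `d_max(R^{Γ_J} ‖ R_A^{Γ_J} ⊗ 1)`. -/
def productBound {Ω : Type*} [MeasurableSpace Ω] {n : ℕ} {I I' : Fin n → Type}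
    (E : Ensemble Ω (∀ j, I j)) (U : Hilb (∀ j, I j) →ₗᵢ[ℂ] Hilb (∀ j, I' j))
    (J : Finset (Fin n)) : ℝ≥0∞ :=
  dmax (partialTranspose₂ J (Rop E U))
    (tensorOne (∀ j, I' j) (partialTranspose J (partialTrace (Rop E U))))

end LOCCBound

end

/-! Everything is expressed through matrix entries in the product bases. The Choi matrix of a
product of completely positive maps is the entrywise product of the local Choi matrices, and
partial transposition transposes some of these factors, so it stays positive. Composition and
limits preserve this, hence LOCC channels are PPT. The average fidelity of `Λ` is the pairing
of its Choi matrix `C` with `R`, and applying `Γ_J` to both factors does not change it. If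
`R^Γ_J ≤ κ ξ ⊗ 1`, positivity of `C^Γ_J` bounds the pairing by that of `C^Γ_J` with `κ ξ ⊗ 1`,
which is `κ` since `Λ` preserves the trace. In infinite dimension the pairing is read on finite
truncations, and Fatou's lemma passes to the limit.

At `J = ∅` the value is at least `1` because every admissible `κ` can be tested on the truncations
of the unnormalised maximally entangled vector `∑ₐ |a⟩ ⊗ U|a⟩`. Complementing `J` amounts to a full
transposition, which preserves positivity. For product states `R_A^Γ_J` is again a state, hence an
admissible `ξ`, and `κ = 1` works because a partially transposed pure state is at most `1`, its
Hilbert–Schmidt norm being `1`. -/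

open scoped ENNReal InnerProductSpace ComplexOrder Topology

noncomputable section

open MeasureTheory Filter

namespace LOCCBound

section PosSemidef

variable {ι β : Type*}

theorem posSemidef_iff_sum {M : Matrix ι ι ℂ} :
    M.PosSemidef ↔ ∀ (s : Finset ι) (v : ι → ℂ),
      0 ≤ ∑ a ∈ s, ∑ b ∈ s, star (v a) * M a b * v b := by
  classical
  constructor
  · intro h s v
    have h_indicator := h.2 (Finsupp.indicator s fun a _ => v a)
    have hsub := Finsupp.support_indicator_subset s (fun a _ => v a)
    rw [Finsupp.sum_of_support_subset _ hsub _ (by simp)] at h_indicator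
    refine h_indicator.trans_eq (Finset.sum_congr rfl fun a ha => ?_)
    rw [Finsupp.sum_of_support_subset _ hsub _ (by simp)]
    refine Finset.sum_congr rfl fun b hb => ?_
    rw [Finsupp.indicator_of_mem ha, Finsupp.indicator_of_mem hb]
  · intro h
    refine ⟨?_, fun x => h x.support x⟩
    have hdiag : ∀ a, (M a a).im = 0 := fun a => by
      simpa using (Complex.nonneg_iff.1 (h {a} fun _ => 1)).2.symm
    ext a b
    rw [Matrix.conjTranspose_apply]
    by_cases hab : a = b
    · subst hab
      exact Complex.conj_eq_iff_im.2 (hdiag a)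
    have h_one := (Complex.nonneg_iff.1 (h {a, b} fun _ => 1)).2
    have h_I := (Complex.nonneg_iff.1 (h {a, b} fun c => if c = a then 1 else Complex.I)).2
    rw [Finset.sum_pair hab, Finset.sum_pair hab, Finset.sum_pair hab] at h_one h_I
    simp only [star_one, one_mul, mul_one, Complex.add_im, hdiag, zero_add, add_zero] at h_one
    simp only [if_true, if_neg (Ne.symm hab), star_one, one_mul, mul_one, RCLike.star_def,
      Complex.conj_I, neg_mul, Complex.add_im, hdiag, Complex.mul_im, Complex.I_im, Complex.I_re,
      mul_zero, add_zero, zero_add, Complex.neg_im, zero_mul, Complex.mul_re, sub_self,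
      neg_zero] at h_I
    exact Complex.ext (by simp; linarith) (by simp; linarith)

theorem posSemidef_of_tendsto {l : Filter β} [l.NeBot] {M : β → Matrix ι ι ℂ} {N : Matrix ι ι ℂ}
    (hM : ∀ x, (M x).PosSemidef) (h : ∀ a b, Tendsto (fun x => M x a b) l (𝓝 (N a b))) :
    N.PosSemidef := by
  refine posSemidef_iff_sum.2 fun s v => ?_
  have hlim : Tendsto (fun x => ∑ a ∈ s, ∑ b ∈ s, star (v a) * M x a b * v b) l
      (𝓝 (∑ a ∈ s, ∑ b ∈ s, star (v a) * N a b * v b)) :=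
    tendsto_finsetSum _ fun a _ => tendsto_finsetSum _ fun b _ =>
      ((h a b).const_mul _).mul_const _
  exact ge_of_tendsto' hlim fun x => posSemidef_iff_sum.1 (hM x) s v

theorem posSemidef_of_hasSum {M : β → Matrix ι ι ℂ} {N : Matrix ι ι ℂ}
    (hM : ∀ x, (M x).PosSemidef) (h : ∀ a b, HasSum (fun x => M x a b) (N a b)) :
    N.PosSemidef :=
  posSemidef_of_tendsto (fun t => Matrix.posSemidef_sum t fun x _ => hM x) fun a b => by
    simpa only [Matrix.sum_apply, HasSum] using h a b

theorem posSemidef_mul_star (v : ι → ℂ) :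
    (Matrix.of fun a b => v a * star (v b)).PosSemidef := by
  refine posSemidef_iff_sum.2 fun s w => ?_
  refine (star_mul_self_nonneg (∑ a ∈ s, star (v a) * w a)).trans_eq ?_
  rw [star_sum, Finset.sum_mul_sum]
  refine Finset.sum_congr rfl fun a _ => Finset.sum_congr rfl fun b _ => ?_
  simp only [Matrix.of_apply, star_mul', star_star]
  ring

theorem posSemidef_prod (t : Finset β) {M : β → Matrix ι ι ℂ}
    (hM : ∀ x, (M x).PosSemidef) : (Matrix.of fun a b => ∏ x ∈ t, M x a b).PosSemidef := by
  classical
  induction t using Finset.induction_on with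
  | empty => simpa using posSemidef_mul_star fun _ : ι => 1
  | insert x t hx ih =>
    have h_insert : (Matrix.of fun a b => ∏ y ∈ insert x t, M y a b) =
        (M x).hadamard (Matrix.of fun a b => ∏ y ∈ t, M y a b) := by
      ext a b
      simp only [Matrix.of_apply, Finset.prod_insert hx, Matrix.hadamard_apply]
    exact h_insert ▸ (hM x).hadamard ih

theorem posSemidef_sum_sum {K : Matrix (ι × β) (ι × β) ℂ} (hK : K.PosSemidef)
    (s : Finset β) : (Matrix.of fun p q => ∑ m ∈ s, ∑ m' ∈ s, K (p, m) (q, m')).PosSemidef := by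
  refine posSemidef_iff_sum.2 fun t v => ?_
  refine (posSemidef_iff_sum.1 hK (t ×ˢ s) fun x => v x.1).trans_eq ?_
  simp only [Finset.sum_product, Matrix.of_apply, Finset.mul_sum, Finset.sum_mul]
  exact Finset.sum_congr rfl fun a _ => Finset.sum_comm

/-- The trace of the product of two matrices, truncated to the finite index set `s`.  It replaces
`Tr[A B]` for matrices that need not be trace class. -/
def trMul (s : Finset ι) (A B : Matrix ι ι ℂ) : ℂ := ∑ a ∈ s, ∑ b ∈ s, A a b * B b a

theorem trMul_nonneg {A B : Matrix ι ι ℂ} (hA : A.PosSemidef) (hB : B.PosSemidef)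
    (s : Finset ι) : 0 ≤ trMul s A B := by
  simpa [trMul] using posSemidef_iff_sum.1 (hA.hadamard hB.transpose) s 1

theorem trMul_sub_left (s : Finset ι) (A A' B : Matrix ι ι ℂ) :
    trMul s (A - A') B = trMul s A B - trMul s A' B := by
  simp only [trMul, Matrix.sub_apply, sub_mul, Finset.sum_sub_distrib]

theorem trMul_smul_left (s : Finset ι) (c : ℂ) (A B : Matrix ι ι ℂ) :
    trMul s (c • A) B = c * trMul s A B := by
  simp only [trMul, Matrix.smul_apply, smul_eq_mul, mul_assoc, Finset.mul_sum]

end PosSemidef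

section Matrices

variable {ι κ : Type}

theorem star_ket (a : ι) : star (ket a : Hilb ι) = ket a := by
  classical
  ext b
  rw [lp.star_apply, ket_apply]
  split_ifs <;> simp

theorem hasSum_ket (x : Hilb ι) : HasSum (fun a => x a • (ket a : Hilb ι)) x := by
  classical
  refine (lp.hasSum_single (p := 2) (by norm_num) x).congr_fun fun a => ?_
  ext b
  rw [lp.coeFn_smul, Pi.smul_apply, ket_apply]
  by_cases hb : b = a
  · subst hb; simp
  · simp [hb]

theorem entry_apply (X : Op ι) (a b : ι) : entry X a b = X (ket b) a :=
  inner_ket a _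

theorem entry_add (X Y : Op ι) : entry (X + Y) = entry X + entry Y := by
  ext a b; simp [entry]

theorem entry_sub (X Y : Op ι) : entry (X - Y) = entry X - entry Y := by
  ext a b; simp [entry]

theorem entry_smul (c : ℂ) (X : Op ι) : entry (c • X) = c • entry X := by
  ext a b; simp [entry]

theorem entry_rankOne (u w : Hilb ι) (a b : ι) :
    entry (InnerProductSpace.rankOne ℂ u w) a b = u a * star (w b) := by
  change ⟪ket a, _⟫_ℂ = _
  rw [InnerProductSpace.inner_right_rankOne_apply, inner_ket, ← inner_conj_symm w, inner_ket,
    starRingEnd_apply]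

theorem entry_ofMatrix {M : Matrix ι ι ℂ} (hM : IsHSMatrix M) : entry (ofMatrix M) = M := by
  rw [ofMatrix, dif_pos hM, entry_hsOp]

theorem entry_injective : Function.Injective (entry : Op ι → Matrix ι ι ℂ) := fun X Y h => by
  refine ContinuousLinearMap.ext fun x => ?_
  have h_ket : ∀ b, X (ket b) = Y (ket b) := fun b => by
    ext a
    simpa only [entry_apply] using congrFun (congrFun h a) b
  have hX := X.hasSum (hasSum_ket x)
  have hY := Y.hasSum (hasSum_ket x)
  simp only [map_smul, h_ket] at hX hY
  exact hX.unique hY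

theorem inner_sum_ket (X : Op ι) (s : Finset ι) (v w : ι → ℂ) :
    ⟪∑ a ∈ s, v a • (ket a : Hilb ι), X (∑ b ∈ s, w b • ket b)⟫_ℂ =
      ∑ a ∈ s, ∑ b ∈ s, star (v a) * entry X a b * w b := by
  simp only [map_sum, map_smul, sum_inner, inner_sum, inner_smul_left, inner_smul_right, entry,
    Matrix.of_apply, Finset.mul_sum]
  rw [Finset.sum_comm]
  refine Finset.sum_congr rfl fun a _ => Finset.sum_congr rfl fun b _ => ?_
  rw [starRingEnd_apply]; ring

theorem tendsto_sum_entry_inner (X : Op ι) (x y : Hilb ι) :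
    Tendsto (fun s : Finset ι => ∑ a ∈ s, ∑ b ∈ s, star (x a) * entry X a b * y b)
      atTop (𝓝 ⟪x, X y⟫_ℂ) := by
  simp only [← inner_sum_ket]
  exact (hasSum_ket x).inner ((X.continuous.tendsto y).comp (hasSum_ket y))

theorem posSemidef_entry_iff {X : Op ι} : (entry X).PosSemidef ↔ X.IsPositive := by
  constructor
  · intro h
    rw [ContinuousLinearMap.isPositive_iff_complex]
    intro x
    have hx : 0 ≤ ⟪x, X x⟫_ℂ :=
      ge_of_tendsto' (tendsto_sum_entry_inner X x x) fun s => posSemidef_iff_sum.1 h s x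
    obtain ⟨h_re, h_im⟩ := Complex.nonneg_iff.1 hx
    rw [← inner_conj_symm, Complex.conj_eq_iff_im.2 h_im.symm]
    exact ⟨Complex.conj_eq_iff_re.1 (Complex.conj_eq_iff_im.2 h_im.symm), h_re⟩
  · intro h
    refine posSemidef_iff_sum.2 fun s v => ?_
    rw [← inner_sum_ket]
    exact h.inner_nonneg_right _

theorem le_iff_posSemidef_entry {X Y : Op ι} : X ≤ Y ↔ (entry Y - entry X).PosSemidef := by
  rw [ContinuousLinearMap.le_def, ← posSemidef_entry_iff, entry_sub]

theorem tensorOne_isPositive {X : Op ι} (hX : X.IsPositive) : (tensorOne κ X).IsPositive := by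
  classical
  rw [← posSemidef_entry_iff]
  have h_entry : entry (tensorOne κ X) = ((entry X).submatrix Prod.fst Prod.fst).hadamard
      ((1 : Matrix κ κ ℂ).submatrix Prod.snd Prod.snd) := by
    ext ⟨a, c⟩ ⟨b, d⟩
    simp [entry_tensorOne, Matrix.one_apply]
  rw [h_entry]
  exact ((posSemidef_entry_iff.2 hX).submatrix _).hadamard (Matrix.PosSemidef.one.submatrix _)

theorem entry_tensorOne_transpose {X Y : Op ι} (h : entry Y = (entry X).transpose) :
    entry (tensorOne κ Y) = (entry (tensorOne κ X)).transpose := by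
  classical
  ext ⟨a, c⟩ ⟨b, d⟩
  rw [Matrix.transpose_apply, entry_tensorOne, entry_tensorOne, h, Matrix.transpose_apply]
  exact if_congr eq_comm rfl rfl

/-- The complex conjugate of an operator in the chosen basis.  For a positive operator this is its
transpose. -/
def conjOp (X : Op ι) : Op ι :=
  ((starL ℂ : Hilb ι ≃L⋆[ℂ] Hilb ι) : Hilb ι →L⋆[ℂ] Hilb ι).comp
    (X.comp ((starL ℂ : Hilb ι ≃L⋆[ℂ] Hilb ι) : Hilb ι →L⋆[ℂ] Hilb ι))

theorem entry_conjOp (X : Op ι) (a b : ι) : entry (conjOp X) a b = star (entry X a b) := by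
  rw [entry_apply, entry_apply]
  change (star (X (star (ket b)))) a = _
  rw [star_ket, lp.star_apply]

theorem entry_conjOp_of_isPositive {X : Op ι} (hX : X.IsPositive) :
    entry (conjOp X) = (entry X).transpose := by
  ext a b
  rw [entry_conjOp, Matrix.transpose_apply, (posSemidef_entry_iff.2 hX).isHermitian.apply]

theorem IsState.conjOp {ξ : Op ι} (h : IsState ξ) : IsState (conjOp ξ) := by
  rw [IsState, ← posSemidef_entry_iff, entry_conjOp_of_isPositive h.1]
  exact ⟨(posSemidef_entry_iff.2 h.1).transpose, h.2⟩

end Matrices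

section Truncation

variable {ι κ : Type}

theorem summable_entry_diag (X : TC ι) : Summable fun a => entry (X : Op ι) a a := by
  obtain ⟨X, hX⟩ := X
  induction hX using Submodule.span_induction with
  | mem x h => exact h.2
  | zero => simp [entry]
  | add x y hx hy h1 h2 => simpa [entry_add] using h1.add h2
  | smul c x hx h => simpa [entry_smul] using h.mul_left c

theorem hasSum_tr (X : TC ι) : HasSum (fun a => entry (X : Op ι) a a) (tr (X : Op ι)) :=
  (summable_entry_diag X).hasSum

theorem hasSum_re_tr (X : TC ι) :
    HasSum (fun a => (entry (X : Op ι) a a).re) (tr (X : Op ι)).re :=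
  Complex.hasSum_re (hasSum_tr X)

theorem exists_re_inner_eq_norm_sq {H : Type*} [NormedAddCommGroup H] [InnerProductSpace ℂ H]
    [CompleteSpace H] {X : H →L[ℂ] H} (hX : X.IsPositive) :
    ∃ S : H →L[ℂ] H, S.IsPositive ∧ ∀ x, (⟪x, X x⟫_ℂ).re = ‖S x‖ ^ 2 := by
  have hX' := (ContinuousLinearMap.nonneg_iff_isPositive _).2 hX
  have hS := (ContinuousLinearMap.nonneg_iff_isPositive _).1 (CFC.sqrt_nonneg X)
  refine ⟨CFC.sqrt X, hS, fun x => ?_⟩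
  conv_lhs => rw [← CFC.sqrt_mul_sqrt_self X hX']
  rw [mul_apply_eq_comp, ← hS.inner_left_eq_inner_right, inner_self_eq_norm_sq_to_K]
  norm_cast

theorem re_inner_le_re_tr {X : TC ι} (hX : (X : Op ι).IsPositive) (u : Hilb ι) :
    (⟪u, (X : Op ι) u⟫_ℂ).re ≤ ‖u‖ ^ 2 * (tr (X : Op ι)).re := by
  obtain ⟨S, hS, hXS⟩ := exists_re_inner_eq_norm_sq hX
  rw [hXS]
  refine hasSum_le (fun a => ?_) (hasSum_normSq (S u)) ((hasSum_re_tr X).mul_left (‖u‖ ^ 2))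
  rw [show (entry (X : Op ι) a a).re = ‖S (ket a)‖ ^ 2 from hXS _, ← mul_pow, ← inner_ket,
    ← hS.inner_left_eq_inner_right, mul_comm]
  exact pow_le_pow_left₀ (norm_nonneg _) (norm_inner_le_norm _ _) 2

/-- The projection onto the span of the basis vectors with label in `s`. -/
def proj (s : Finset ι) : Op ι := ∑ a ∈ s, InnerProductSpace.rankOne ℂ (ket a) (ket a)

theorem isSelfAdjoint_proj (s : Finset ι) : IsSelfAdjoint (proj s) := by
  rw [ContinuousLinearMap.isSelfAdjoint_iff', proj, map_sum]
  simp only [InnerProductSpace.adjoint_rankOne]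

theorem proj_ket [DecidableEq ι] (s : Finset ι) (b : ι) :
    proj s (ket b) = if b ∈ s then (ket b : Hilb ι) else 0 := by
  simp [proj, inner_ket, ket_apply]

theorem entry_proj_mul_mul_proj [DecidableEq ι] (s : Finset ι) (T : Op ι) (a : ι) :
    entry (proj s * T * proj s) a a = if a ∈ s then entry T a a else 0 := by
  change ⟪ket a, proj s (T (proj s (ket a)))⟫_ℂ = _
  rw [← ContinuousLinearMap.adjoint_inner_left, (isSelfAdjoint_proj s).adjoint_eq, proj_ket]
  split_ifs <;> simp [entry]

theorem entry_compl_proj_mul_mul_compl_proj [DecidableEq ι] (s : Finset ι) (T : Op ι) (a : ι) :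
    entry ((1 - proj s) * T * (1 - proj s)) a a = if a ∈ s then 0 else entry T a a := by
  change ⟪ket a, (1 - proj s) (T ((1 - proj s) (ket a)))⟫_ℂ = _
  rw [← ContinuousLinearMap.adjoint_inner_left,
    ((IsSelfAdjoint.one _).sub (isSelfAdjoint_proj s)).adjoint_eq, sub_apply,
    one_apply_eq_self, proj_ket]
  split_ifs <;> simp [entry]

theorem isPositive_mul_mul {S T : Op ι} (hS : IsSelfAdjoint S) (hT : T.IsPositive) :
    (S * T * S).IsPositive :=
  (ContinuousLinearMap.nonneg_iff_isPositive _).1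
    (hS.conjugate_nonneg ((ContinuousLinearMap.nonneg_iff_isPositive _).2 hT))

/-- The truncation `P T P` of an operator to the basis vectors with label in `s`, as a trace class
operator. -/
def trunc (s : Finset ι) : Op ι →ₗ[ℂ] TC ι where
  toFun T := ∑ a ∈ s, ∑ b ∈ s, entry T a b • ketbra (ket a) (ket b)
  map_add' X Y := by simp [entry_add, add_smul, Finset.sum_add_distrib]
  map_smul' c X := by simp [entry_smul, mul_smul, Finset.smul_sum]

theorem coe_trunc (s : Finset ι) (T : Op ι) : (trunc s T : Op ι) = proj s * T * proj s := by
  refine ContinuousLinearMap.ext fun x => ?_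
  simp only [trunc, proj, ketbra, LinearMap.coe_mk, AddHom.coe_mk, Submodule.coe_sum,
    Submodule.coe_smul, sum_apply, smul_apply, mul_apply_eq_comp,
    InnerProductSpace.rankOne_apply, map_sum, map_smul, entry, Matrix.of_apply, Finset.smul_sum]
  rw [Finset.sum_comm]
  exact Finset.sum_congr rfl fun a _ => Finset.sum_congr rfl fun b _ => smul_comm _ _ _

/-- The compression `(1 - P) T (1 - P)` of a positive trace class operator to the orthogonal
complement of the basis vectors with label in `s`. -/
def cotrunc (s : Finset ι) (T : TC ι) (hT : (T : Op ι).IsPositive) : TC ι :=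
  ⟨(1 - proj s) * T * (1 - proj s), Submodule.subset_span
    ⟨isPositive_mul_mul ((IsSelfAdjoint.one _).sub (isSelfAdjoint_proj s)) hT, by
      classical
      refine ((summable_entry_diag T).indicator {a | a ∉ s}).congr fun a => ?_
      rw [entry_compl_proj_mul_mul_compl_proj]
      by_cases ha : a ∈ s <;> simp [ha]⟩⟩

theorem trunc_isPositive (s : Finset ι) {T : Op ι} (hT : T.IsPositive) :
    (trunc s T : Op ι).IsPositive :=
  coe_trunc s T ▸ isPositive_mul_mul (isSelfAdjoint_proj s) hT

theorem cotrunc_isPositive (s : Finset ι) {T : TC ι} (hT : (T : Op ι).IsPositive) :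
    (cotrunc s T hT : Op ι).IsPositive :=
  isPositive_mul_mul ((IsSelfAdjoint.one _).sub (isSelfAdjoint_proj s)) hT

theorem re_tr_trunc (s : Finset ι) (T : Op ι) :
    (tr (trunc s T : Op ι)).re = ∑ a ∈ s, (entry T a a).re := by
  classical
  rw [tr, coe_trunc, ← Complex.re_sum]
  simp only [entry_proj_mul_mul_proj]
  rw [tsum_eq_sum fun a ha => if_neg ha]
  exact congrArg _ (Finset.sum_congr rfl fun a ha => if_pos ha)

theorem re_tr_cotrunc (s : Finset ι) {T : TC ι} (hT : (T : Op ι).IsPositive) :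
    (tr (cotrunc s T hT : Op ι)).re =
      (tr (T : Op ι)).re - ∑ a ∈ s, (entry (T : Op ι) a a).re := by
  classical
  rw [eq_sub_iff_add_eq, ← re_tr_trunc]
  refine ((hasSum_re_tr _).add (hasSum_re_tr _)).unique ((hasSum_re_tr T).congr_fun fun a => ?_)
  rw [coe_trunc, cotrunc, entry_proj_mul_mul_proj, entry_compl_proj_mul_mul_compl_proj]
  split_ifs <;> simp

/-- Positivity of `(r P + Q) T (r P + Q)`, with `Q = 1 - P`, for all real `r`: this gives a
Cauchy–Schwarz inequality for the off-diagonal blocks of `T`. -/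
theorem isPositive_pencil (s : Finset ι) {T : TC ι} (hT : (T : Op ι).IsPositive) (r : ℝ) :
    (((r * r : ℂ) • trunc s (T : Op ι) + (r : ℂ) • (T - trunc s (T : Op ι) - cotrunc s T hT) +
      cotrunc s T hT : TC ι) : Op ι).IsPositive := by
  have hr : IsSelfAdjoint (r : ℂ) := Complex.conj_ofReal r
  have h := isPositive_mul_mul ((hr.smul (isSelfAdjoint_proj s)).add
    ((IsSelfAdjoint.one _).sub (isSelfAdjoint_proj s))) hT
  convert h using 1
  simp only [Submodule.coe_add, Submodule.coe_sub, Submodule.coe_smul, coe_trunc, cotrunc, add_mul,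
    mul_add, smul_mul_assoc, mul_smul_comm, sub_mul, mul_sub, one_mul, mul_one]
  module

section PositiveFunctional

variable {f : TC ι →ₗ[ℂ] ℂ}

theorem abs_re_sub_trunc_sub_cotrunc_le (hf : ∀ T : TC ι, (T : Op ι).IsPositive → 0 ≤ f T)
    (s : Finset ι) {T : TC ι} (hT : (T : Op ι).IsPositive) :
    |(f T).re - (f (trunc s (T : Op ι))).re - (f (cotrunc s T hT)).re| ≤
      2 * √((f (trunc s (T : Op ι))).re * (f (cotrunc s T hT)).re) := by
  have h_quad (r : ℝ) : 0 ≤ (f (trunc s (T : Op ι))).re * (r * r) +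
      ((f T).re - (f (trunc s (T : Op ι))).re - (f (cotrunc s T hT)).re) * r +
      (f (cotrunc s T hT)).re := by
    have h := (Complex.nonneg_iff.1 (hf _ (isPositive_pencil s hT r))).1
    simpa [← Complex.ofReal_mul, mul_comm] using h
  have h := discrim_le_zero h_quad
  refine abs_le_of_sq_le_sq ?_ (by positivity)
  rw [mul_pow, Real.sq_sqrt (mul_nonneg (Complex.nonneg_iff.1 (hf _ (trunc_isPositive s hT))).1
    (Complex.nonneg_iff.1 (hf _ (cotrunc_isPositive s hT))).1)]
  rw [discrim] at h
  linarith

theorem tendsto_trunc_of_isPositive (hf : ∀ T : TC ι, (T : Op ι).IsPositive → 0 ≤ f T)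
    {C : ℝ} (hC : 0 ≤ C)
    (hfC : ∀ T : TC ι, (T : Op ι).IsPositive → (f T).re ≤ C * (tr (T : Op ι)).re)
    {T : TC ι} (hT : (T : Op ι).IsPositive) :
    Tendsto (fun s : Finset ι => f (trunc s (T : Op ι))) atTop (𝓝 (f T)) := by
  let p (s : Finset ι) : ℝ := (f (trunc s (T : Op ι))).re
  let q (s : Finset ι) : ℝ := (f (cotrunc s T hT)).re
  let t : ℝ := (tr (T : Op ι)).re
  have hq_nonneg (s) : 0 ≤ q s := (Complex.nonneg_iff.1 (hf _ (cotrunc_isPositive s hT))).1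
  have hp_le (s) : p s ≤ C * t := by
    refine (hfC _ (trunc_isPositive s hT)).trans (mul_le_mul_of_nonneg_left ?_ hC)
    rw [re_tr_trunc]
    exact sum_le_hasSum s (fun a _ => (Complex.nonneg_iff.1
      (posSemidef_entry_iff.2 hT).diag_nonneg).1) (hasSum_re_tr T)
  have hq_lim : Tendsto q atTop (𝓝 0) := by
    refine squeeze_zero hq_nonneg (fun s => hfC _ (cotrunc_isPositive s hT)) ?_
    simp only [re_tr_cotrunc]
    have h : Tendsto (fun s => C * (t - ∑ a ∈ s, (entry (T : Op ι) a a).re)) atTop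
        (𝓝 (C * (t - t))) := ((hasSum_re_tr T).const_sub t).const_mul C
    simpa only [sub_self, mul_zero] using h
  have hp_lim : Tendsto p atTop (𝓝 (f T).re) := by
    have h_bound (s) : |(f T).re - p s - q s| ≤ 2 * √(C * t * q s) :=
      (abs_re_sub_trunc_sub_cotrunc_le hf s hT).trans (mul_le_mul_of_nonneg_left
        (Real.sqrt_le_sqrt (mul_le_mul_of_nonneg_right (hp_le s) (hq_nonneg s))) zero_le_two)
    have h_lim : Tendsto (fun s => 2 * √(C * t * q s)) atTop (𝓝 0) := by
      simpa using ((hq_lim.const_mul (C * t)).sqrt).const_mul 2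
    have h := ((squeeze_zero_norm h_bound h_lim).add hq_lim).const_sub (f T).re
    simpa using h
  have h_real {X : TC ι} (hX : (X : Op ι).IsPositive) : f X = ((f X).re : ℂ) :=
    (Complex.conj_eq_iff_re.1
      (Complex.conj_eq_iff_im.2 (Complex.nonneg_iff.1 (hf X hX)).2.symm)).symm
  rw [h_real hT]
  exact ((Complex.continuous_ofReal.tendsto _).comp hp_lim).congr fun s =>
    (h_real (trunc_isPositive s hT)).symm

theorem tendsto_trunc_of_nonneg (hf : ∀ T : TC ι, (T : Op ι).IsPositive → 0 ≤ f T)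
    {C : ℝ} (hC : 0 ≤ C)
    (hfC : ∀ T : TC ι, (T : Op ι).IsPositive → (f T).re ≤ C * (tr (T : Op ι)).re) (T : TC ι) :
    Tendsto (fun s : Finset ι => f (trunc s (T : Op ι))) atTop (𝓝 (f T)) := by
  obtain ⟨T, hT⟩ := T
  induction hT using Submodule.span_induction with
  | mem x h =>
    exact tendsto_trunc_of_isPositive hf hC hfC (T := ⟨x, Submodule.subset_span h⟩) h.1
  | zero =>
    have h_mk : (⟨0, Submodule.zero_mem _⟩ : TC ι) = 0 := rfl
    simp [h_mk]
  | add x y hx hy h1 h2 =>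
    have h_mk : (⟨x + y, Submodule.add_mem _ hx hy⟩ : TC ι) = ⟨x, hx⟩ + ⟨y, hy⟩ := rfl
    simpa only [h_mk, map_add, Submodule.coe_add] using h1.add h2
  | smul c x hx h =>
    have h_mk : (⟨c • x, Submodule.smul_mem _ c hx⟩ : TC ι) = c • ⟨x, hx⟩ := rfl
    simpa only [h_mk, map_smul, Submodule.coe_smul, smul_eq_mul] using h.const_mul c

end PositiveFunctional

theorem tendsto_inner_of_tendsto_inner_self {H β : Type*} [NormedAddCommGroup H]
    [InnerProductSpace ℂ H] {l : Filter β} {F : β → H →L[ℂ] H} {X : H →L[ℂ] H}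
    (h : ∀ u, Tendsto (fun s => ⟪u, F s u⟫_ℂ) l (𝓝 ⟪u, X u⟫_ℂ)) (u w : H) :
    Tendsto (fun s => ⟪u, F s w⟫_ℂ) l (𝓝 ⟪u, X w⟫_ℂ) := by
  have h_conj (u w : H) (h' : Tendsto (fun s => ⟪u, F s w⟫_ℂ) l (𝓝 ⟪u, X w⟫_ℂ)) :
      Tendsto (fun s => ⟪F s w, u⟫_ℂ) l (𝓝 ⟪X w, u⟫_ℂ) := by
    simpa only [Function.comp_def, inner_conj_symm] using
      (Complex.continuous_conj.tendsto _).comp h'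
  have h_polar (Y : H →L[ℂ] H) := inner_map_polarization (Y : H →ₗ[ℂ] H) u w
  suffices h' : Tendsto (fun s => ⟪F s w, u⟫_ℂ) l (𝓝 ⟪X w, u⟫_ℂ) by
    simpa only [Function.comp_def, inner_conj_symm] using
      (Complex.continuous_conj.tendsto _).comp h'
  simp only [ContinuousLinearMap.coe_coe] at h_polar
  simp only [h_polar]
  have h_self (u : H) := h_conj u u (h u)
  exact ((((h_self _).sub (h_self _)).add ((h_self _).const_mul _)).sub
    ((h_self _).const_mul _)).div_const _

theorem IsCP.isPositive {Φ : TC ι →ₗ[ℂ] TC κ} (hΦ : IsCP Φ) {T : TC ι}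
    (hT : (T : Op ι).IsPositive) : (Φ T : Op κ).IsPositive := by
  have h := hΦ 1 (fun _ _ => T) fun v => by simpa using hT.inner_nonneg_right (v 0)
  rw [← posSemidef_entry_iff]
  refine posSemidef_iff_sum.2 fun s v => ?_
  rw [← inner_sum_ket]
  simpa using h fun _ => ∑ a ∈ s, v a • ket a

theorem IsChannel.tendsto_trunc {Φ : TC ι →ₗ[ℂ] TC κ} (hΦ : IsChannel Φ) (T : TC ι)
    (u w : Hilb κ) :
    Tendsto (fun s : Finset ι => ⟪u, (Φ (trunc s (T : Op ι)) : Op κ) w⟫_ℂ) atTop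
      (𝓝 ⟪u, (Φ T : Op κ) w⟫_ℂ) := by
  refine tendsto_inner_of_tendsto_inner_self (fun u => ?_) u w
  let f : TC ι →ₗ[ℂ] ℂ :=
    { toFun := fun T => ⟪u, (Φ T : Op κ) u⟫_ℂ
      map_add' := fun X Y => by simp
      map_smul' := fun c X => by simp }
  refine tendsto_trunc_of_nonneg (f := f)
    (fun T hT => (hΦ.1.isPositive hT).inner_nonneg_right u) (sq_nonneg ‖u‖) (fun T hT => ?_) T
  rw [← hΦ.2 T]
  exact re_inner_le_re_tr (hΦ.1.isPositive hT) u

end Truncation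

section PartialSwap

variable {σ : Type*} [DecidableEq σ] {X Y : σ → Type*}

/-- The exchange of the components with index in `J` of two families.  Partial transposition of a
matrix is composition with this permutation of the pairs (row, column). -/
def partialSwap (J : Finset σ) : Equiv.Perm ((∀ j, X j) × (∀ j, X j)) :=
  Function.Involutive.toPerm (fun x => (J.piecewise x.2 x.1, J.piecewise x.1 x.2)) fun x => by
    ext j <;> by_cases hj : j ∈ J <;> simp [hj]

/-- The variant of `partialSwap` that exchanges the components of pairs of families. -/
def partialSwap₂ (J : Finset σ) :
    Equiv.Perm (((∀ j, X j) × (∀ j, Y j)) × ((∀ j, X j) × (∀ j, Y j))) :=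
  (Equiv.prodProdProdComm _ _ _ _).trans
    (((partialSwap J).prodCongr (partialSwap J)).trans (Equiv.prodProdProdComm _ _ _ _))

theorem partialSwap_mem_piFinset_iff [Fintype σ] (J : Finset σ) (S : ∀ j, Finset (X j))
    (x : (∀ j, X j) × (∀ j, X j)) :
    partialSwap J x ∈ Fintype.piFinset S ×ˢ Fintype.piFinset S ↔
      x ∈ Fintype.piFinset S ×ˢ Fintype.piFinset S := by
  simp only [Finset.mem_product, Fintype.mem_piFinset, ← forall_and]
  refine forall_congr' fun j => ?_
  change J.piecewise x.2 x.1 j ∈ S j ∧ J.piecewise x.1 x.2 j ∈ S j ↔ _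
  by_cases hj : j ∈ J <;> simp [hj, and_comm]

theorem partialSwap₂_mem_piFinset_iff [Fintype σ] (J : Finset σ) (S : ∀ j, Finset (X j))
    (T : ∀ j, Finset (Y j)) (x : ((∀ j, X j) × (∀ j, Y j)) × ((∀ j, X j) × (∀ j, Y j))) :
    partialSwap₂ J x ∈ (Fintype.piFinset S ×ˢ Fintype.piFinset T) ×ˢ
        (Fintype.piFinset S ×ˢ Fintype.piFinset T) ↔
      x ∈ (Fintype.piFinset S ×ˢ Fintype.piFinset T) ×ˢ
        (Fintype.piFinset S ×ˢ Fintype.piFinset T) := by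
  have hX := partialSwap_mem_piFinset_iff J S (x.1.1, x.2.1)
  have hY := partialSwap_mem_piFinset_iff J T (x.1.2, x.2.2)
  simp only [Finset.mem_product] at hX hY ⊢
  exact and_and_and_comm.trans ((and_congr hX hY).trans and_and_and_comm)

theorem sum_sum_partialSwap [Fintype σ] {R : Type*} [AddCommMonoid R] (J : Finset σ)
    (S : ∀ j, Finset (X j)) (F : (∀ j, X j) × (∀ j, X j) → R) :
    ∑ a ∈ Fintype.piFinset S, ∑ b ∈ Fintype.piFinset S, F (partialSwap J (a, b)) =
      ∑ a ∈ Fintype.piFinset S, ∑ b ∈ Fintype.piFinset S, F (a, b) := by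
  rw [← Finset.sum_product _ _ fun x => F (partialSwap J x), ← Finset.sum_product _ _ F]
  exact Finset.sum_equiv (partialSwap J)
    (fun x => (partialSwap_mem_piFinset_iff J S x).symm) fun _ _ => rfl

end PartialSwap

section PartialTranspose

variable {n : ℕ} {I I' : Fin n → Type}

theorem IsHSMatrix.ptMatrix (J : Finset (Fin n)) {M : Matrix (∀ j, I j) (∀ j, I j) ℂ}
    (hM : IsHSMatrix M) : IsHSMatrix (ptMatrix J M) :=
  (partialSwap J).summable_iff.2 hM

theorem IsHSMatrix.ptMatrix₂ (J : Finset (Fin n))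
    {M : Matrix ((∀ j, I j) × (∀ j, I' j)) ((∀ j, I j) × (∀ j, I' j)) ℂ} (hM : IsHSMatrix M) :
    IsHSMatrix (ptMatrix₂ J M) :=
  (partialSwap₂ J).summable_iff.2 hM

theorem ptMatrix_compl (J : Finset (Fin n)) (M : Matrix (∀ j, I j) (∀ j, I j) ℂ) :
    ptMatrix Jᶜ M = (ptMatrix J M).transpose := by
  ext p q
  simp only [ptMatrix, Matrix.of_apply, Matrix.transpose_apply, Finset.piecewise_compl]

theorem ptMatrix₂_compl (J : Finset (Fin n))
    (M : Matrix ((∀ j, I j) × (∀ j, I' j)) ((∀ j, I j) × (∀ j, I' j)) ℂ) :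
    ptMatrix₂ Jᶜ M = (ptMatrix₂ J M).transpose := by
  ext p q
  simp only [ptMatrix₂, Matrix.of_apply, Matrix.transpose_apply, Finset.piecewise_compl]

theorem ptMatrix₂_empty (M : Matrix ((∀ j, I j) × (∀ j, I' j)) ((∀ j, I j) × (∀ j, I' j)) ℂ) :
    ptMatrix₂ ∅ M = M := by
  ext p q
  simp only [ptMatrix₂, Matrix.of_apply, Finset.piecewise_empty]

theorem trMul_ptMatrix₂ (J : Finset (Fin n)) (S : ∀ j, Finset (I j)) (T : ∀ j, Finset (I' j))
    (A B : Matrix ((∀ j, I j) × (∀ j, I' j)) ((∀ j, I j) × (∀ j, I' j)) ℂ) :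
    trMul (Fintype.piFinset S ×ˢ Fintype.piFinset T) (ptMatrix₂ J A) (ptMatrix₂ J B) =
      trMul (Fintype.piFinset S ×ˢ Fintype.piFinset T) A B := by
  rw [trMul, trMul, ← Finset.sum_product', ← Finset.sum_product']
  exact Finset.sum_equiv (partialSwap₂ J)
    (fun x => (partialSwap₂_mem_piFinset_iff J S T x).symm) fun _ _ => rfl

open Classical in
/-- The sides of the smallest box that contains a finite set of families. -/
def boxSides (s : Finset (∀ j, I j)) (j : Fin n) : Finset (I j) := s.image fun a => a j

theorem tendsto_piFinset_boxSides :
    Tendsto (fun s : Finset (∀ j, I j) => Fintype.piFinset (boxSides s)) atTop atTop := by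
  classical
  refine tendsto_atTop_mono (fun s a ha => Fintype.mem_piFinset.2 fun j => ?_) tendsto_id
  exact Finset.mem_image_of_mem _ ha

end PartialTranspose

section PPT

variable {ι κ μ : Type}

theorem IsCP.choi_posSemidef {Φ : TC ι →ₗ[ℂ] TC κ} (hΦ : IsCP Φ) : (choi Φ).PosSemidef := by
  refine posSemidef_iff_sum.2 fun s v => ?_
  let e := s.equivFin.symm
  have h_block : BlockPositive fun i j =>
      (ketbra (ket (e i).1.1) (ket (e j).1.1) : Op ι) := fun w => by
    refine (star_mul_self_nonneg (∑ j, ⟪ket (e j).1.1, w j⟫_ℂ)).trans_eq ?_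
    rw [star_sum, Finset.sum_mul_sum]
    refine Finset.sum_congr rfl fun i _ => Finset.sum_congr rfl fun j _ => ?_
    change _ = ⟪w i, InnerProductSpace.rankOne ℂ _ _ (w j)⟫_ℂ
    rw [InnerProductSpace.inner_right_rankOne_apply, ← inner_conj_symm (w i), starRingEnd_apply]
  have h_sum (F : ι × κ → ℂ) : ∑ i, F (e i).1 = ∑ p ∈ s, F p :=
    (e.sum_comp fun x => F x.1).trans (Finset.sum_coe_sort s F)
  refine (hΦ s.card _ h_block fun i => v (e i).1 • ket (e i).1.2).trans_eq ?_
  simp only [← h_sum]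
  refine Finset.sum_congr rfl fun i _ => Finset.sum_congr rfl fun j _ => ?_
  simp only [map_smul, inner_smul_left, inner_smul_right, choi, entry, Matrix.of_apply,
    starRingEnd_apply]
  ring

/-- The link product of two matrices, truncated to the finite set `s` of labels of the intermediate
system.  The Choi matrix of a composition is the limit of link products of Choi matrices. -/
def linkProduct (s : Finset μ) (A : Matrix (ι × μ) (ι × μ) ℂ) (B : Matrix (μ × κ) (μ × κ) ℂ) :
    Matrix (ι × κ) (ι × κ) ℂ :=
  Matrix.of fun p q => ∑ m ∈ s, ∑ m' ∈ s, A (p.1, m) (q.1, m') * B (m, p.2) (m', q.2)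

theorem linkProduct_posSemidef (s : Finset μ) {A : Matrix (ι × μ) (ι × μ) ℂ}
    {B : Matrix (μ × κ) (μ × κ) ℂ} (hA : A.PosSemidef) (hB : B.PosSemidef) :
    (linkProduct s A B).PosSemidef :=
  posSemidef_sum_sum ((hA.submatrix fun x : (ι × κ) × μ => (x.1.1, x.2)).hadamard
    (hB.submatrix fun x : (ι × κ) × μ => (x.2, x.1.2))) s

theorem IsChannel.tendsto_linkProduct_choi {Φ : TC μ →ₗ[ℂ] TC κ} (hΦ : IsChannel Φ)
    (G : TC ι →ₗ[ℂ] TC μ) (p q : ι × κ) :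
    Tendsto (fun s => linkProduct s (choi G) (choi Φ) p q) atTop (𝓝 (choi (Φ ∘ₗ G) p q)) := by
  refine (hΦ.tendsto_trunc (G (ketbra (ket p.1) (ket q.1))) (ket p.2) (ket q.2)).congr fun s => ?_
  simp [trunc, linkProduct, choi, entry]

theorem prod_ket {n : ℕ} {I : Fin n → Type} (a b : ∀ j, I j) :
    (ket a : Hilb (∀ j, I j)) b = ∏ j, (ket (a j) : Hilb (I j)) (b j) := by
  classical
  simp only [ket_apply, Finset.prod_ite_zero, Finset.mem_univ, true_imp_iff, Finset.prod_const_one,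
    funext_iff]

theorem isTensor_ketbra {n : ℕ} {I : Fin n → Type} (a b : ∀ j, I j) :
    IsTensor (fun j => (ketbra (ket (a j)) (ket (b j)) : Op (I j)))
      (ketbra (ket a) (ket b) : Op (∀ j, I j)) := by
  intro c d
  simp only [ketbra, entry_rankOne, prod_ket, star_prod, Finset.prod_mul_distrib]

variable {n : ℕ} {I M I' : Fin n → Type}

theorem ptMatrix₂_linkProduct (J : Finset (Fin n)) (S : ∀ j, Finset (M j))
    (A : Matrix ((∀ j, I j) × (∀ j, M j)) ((∀ j, I j) × (∀ j, M j)) ℂ)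
    (B : Matrix ((∀ j, M j) × (∀ j, I' j)) ((∀ j, M j) × (∀ j, I' j)) ℂ) :
    ptMatrix₂ J (linkProduct (Fintype.piFinset S) A B) =
      linkProduct (Fintype.piFinset S) (ptMatrix₂ J A) (ptMatrix₂ J B) := by
  ext p q
  exact (sum_sum_partialSwap J S fun x =>
    A (J.piecewise q.1 p.1, x.1) (J.piecewise p.1 q.1, x.2) *
      B (x.1, J.piecewise q.2 p.2) (x.2, J.piecewise p.2 q.2)).symm

theorem ptMatrix₂_choi_comp_posSemidef {Φ : TC (∀ j, M j) →ₗ[ℂ] TC (∀ j, I' j)}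
    (hΦ : IsChannel Φ) {G : TC (∀ j, I j) →ₗ[ℂ] TC (∀ j, M j)} {J : Finset (Fin n)}
    (hΦJ : (ptMatrix₂ J (choi Φ)).PosSemidef) (hGJ : (ptMatrix₂ J (choi G)).PosSemidef) :
    (ptMatrix₂ J (choi (Φ ∘ₗ G))).PosSemidef := by
  refine posSemidef_of_tendsto (l := atTop) (fun s : Finset (∀ j, M j) =>
    linkProduct_posSemidef (Fintype.piFinset (boxSides s)) hGJ hΦJ) fun p q => ?_
  have h_lim := (hΦ.tendsto_linkProduct_choi G (J.piecewise q.1 p.1, J.piecewise q.2 p.2)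
    (J.piecewise p.1 q.1, J.piecewise p.2 q.2)).comp tendsto_piFinset_boxSides
  exact h_lim.congr fun s =>
    congrFun (congrFun (ptMatrix₂_linkProduct J (boxSides s) (choi G) (choi Φ)) p) q

theorem IsProductMap.choi_apply {L : ∀ j, TC (I j) →ₗ[ℂ] TC (M j)}
    {G : TC (∀ j, I j) →ₗ[ℂ] TC (∀ j, M j)} (h : IsProductMap L G)
    (p q : (∀ j, I j) × (∀ j, M j)) :
    choi G p q = ∏ j, choi (L j) (p.1 j, p.2 j) (q.1 j, q.2 j) :=
  h _ _ (isTensor_ketbra p.1 q.1) p.2 q.2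

theorem IsProductMap.ptMatrix₂_choi_posSemidef {L : ∀ j, TC (I j) →ₗ[ℂ] TC (M j)}
    {G : TC (∀ j, I j) →ₗ[ℂ] TC (∀ j, M j)} (h : IsProductMap L G) (hL : ∀ j, IsCP (L j))
    (J : Finset (Fin n)) : (ptMatrix₂ J (choi G)).PosSemidef := by
  have h_prod : ptMatrix₂ J (choi G) = Matrix.of fun p q => ∏ j,
      ((if j ∈ J then (choi (L j)).transpose else choi (L j)).submatrix
        (fun p : (∀ j, I j) × (∀ j, M j) => (p.1 j, p.2 j)) fun p => (p.1 j, p.2 j)) p q := by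
    ext p q
    simp only [ptMatrix₂, Matrix.of_apply, h.choi_apply]
    refine Finset.prod_congr rfl fun j _ => ?_
    by_cases hj : j ∈ J <;> simp [hj]
  rw [h_prod]
  refine posSemidef_prod _ fun j => Matrix.PosSemidef.submatrix ?_ _
  split_ifs
  · exact (hL j).choi_posSemidef.transpose
  · exact (hL j).choi_posSemidef

theorem LOCCProtocol.isPPT {Λ : TC (∀ j, I j) →ₗ[ℂ] TC (∀ j, I' j)} (h : LOCCProtocol Λ) :
    IsPPT Λ := by
  induction h with
  | final L hL Λ hΛ hprod => exact ⟨hΛ, hprod.ptMatrix₂_choi_posSemidef fun j => (hL j).1⟩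
  | round _ _ _ L hCP _ _ G _ hprod Φ _ Λ hΛ hsum ih =>
    exact ⟨hΛ, fun J => posSemidef_of_hasSum (fun x => ptMatrix₂_choi_comp_posSemidef (ih x).1
      ((ih x).2 J) ((hprod x).ptMatrix₂_choi_posSemidef (hCP x) J)) fun _ _ => hsum _ _ _⟩

theorem IsLOCC.isPPT {Λ : TC (∀ j, I j) →ₗ[ℂ] TC (∀ j, I' j)} (h : IsLOCC Λ) : IsPPT Λ := by
  obtain ⟨hΛ, S, hS, hlim⟩ := h
  exact ⟨hΛ, fun J => posSemidef_of_tendsto (fun r => (hS r).isPPT.2 J) fun _ _ => hlim _ _ _⟩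

theorem loccFidelity_le_pptFidelity {Ω : Type*} [MeasurableSpace Ω] (E : Ensemble Ω (∀ j, I j))
    (U : Hilb (∀ j, I j) →ₗᵢ[ℂ] Hilb (∀ j, I' j)) : loccFidelity E U ≤ pptFidelity E U :=
  iSup₂_le fun Λ hΛ => le_iSup₂ (f := fun Λ (_ : IsPPT Λ) => avgFidelity E U Λ) Λ hΛ.isPPT

end PPT

section TensorVec

variable {ι κ : Type}

theorem norm_tensorVec (u : Hilb ι) (w : Hilb κ) : ‖tensorVec u w‖ = ‖u‖ * ‖w‖ := by
  have h_mul := (hasSum_normSq u).mul (hasSum_normSq w)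
    ((hasSum_normSq u).summable.mul_of_nonneg (hasSum_normSq w).summable
      (fun _ => by positivity) (fun _ => by positivity))
  have h_sq := (hasSum_normSq (tensorVec u w)).unique (h_mul.congr_fun fun p => by
    change ‖u p.1 * w p.2‖ ^ 2 = _
    rw [norm_mul, mul_pow])
  rw [← mul_pow] at h_sq
  exact (pow_left_inj₀ (norm_nonneg _) (by positivity) two_ne_zero).1 h_sq

theorem continuous_tensorVec :
    Continuous fun x : Hilb ι × Hilb κ => tensorVec x.1 x.2 :=
  IsBoundedBilinearMap.continuous (𝕜 := ℂ)
    { add_left := fun x y z => by ext p; exact add_mul _ _ _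
      smul_left := fun c x y => by ext p; exact mul_assoc _ _ _
      add_right := fun x y z => by ext p; exact mul_add _ _ _
      smul_right := fun c x y => by ext p; exact mul_left_comm _ _ _
      bound := ⟨1, one_pos, fun x y => by rw [norm_tensorVec, one_mul]⟩ }

theorem continuous_coord (a : ι) : Continuous fun x : Hilb ι => x a := by
  simp only [← inner_ket]
  fun_prop

theorem norm_coord_le (x : Hilb ι) (a : ι) : ‖x a‖ ≤ ‖x‖ :=
  lp.norm_apply_le_norm two_ne_zero x a

end TensorVec

section SecondMoment

variable {Ω : Type*} [MeasurableSpace Ω] {μ : Measure Ω} {ι : Type} {v w : Ω → Hilb ι}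

/-- The matrix of the average of `|v⟩⟨v|` over a random vector `v`. -/
def secondMoment (μ : Measure Ω) (v : Ω → Hilb ι) : Matrix ι ι ℂ :=
  Matrix.of fun a b => ∫ α, v α a * star (v α b) ∂μ

theorem memLp_coord (hv : MemLp v 2 μ) (a : ι) : MemLp (fun α => v α a) 2 μ :=
  hv.mono ((continuous_coord a).comp_aestronglyMeasurable hv.1)
    (ae_of_all _ fun α => norm_coord_le (v α) a)

theorem integrable_coord_mul_star_coord (hv : MemLp v 2 μ) (hw : MemLp w 2 μ) (a b : ι) :
    Integrable (fun α => v α a * star (w α b)) μ :=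
  (memLp_coord hv a).integrable_mul (memLp_coord hw b).star

theorem integrable_norm_mul_norm {E F : Type*} [NormedAddCommGroup E] [NormedAddCommGroup F]
    {x : Ω → E} {y : Ω → F} (hx : MemLp x 2 μ) (hy : MemLp y 2 μ) :
    Integrable (fun α => ‖x α‖ * ‖y α‖) μ :=
  hx.norm.integrable_mul hy.norm

theorem inner_integral_rankOne (hv : MemLp v 2 μ) (x y : Hilb ι) :
    ⟪x, (∫ α, InnerProductSpace.rankOne ℂ (v α) (v α) ∂μ) y⟫_ℂ =
      ∫ α, ⟪x, v α⟫_ℂ * ⟪v α, y⟫_ℂ ∂μ := by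
  have h_cont : Continuous fun x : Hilb ι => InnerProductSpace.rankOne ℂ x x :=
    ((ContinuousLinearMap.smulRightL ℂ (Hilb ι) (Hilb ι)).continuous.comp
      (innerSL ℂ).continuous).clm_apply continuous_id
  have h_int : Integrable (fun α => InnerProductSpace.rankOne ℂ (v α) (v α)) μ :=
    (integrable_norm_mul_norm hv hv).mono' (h_cont.comp_aestronglyMeasurable hv.1)
      (ae_of_all _ fun α => (InnerProductSpace.norm_rankOne _ _).le)
  let L : Op ι →L[ℂ] ℂ := (innerSL ℂ x).comp (ContinuousLinearMap.apply ℂ (Hilb ι) y)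
  exact (L.integral_comp_comm h_int).symm.trans (integral_congr_ae (ae_of_all _ fun α =>
    InnerProductSpace.inner_right_rankOne_apply x (v α) (v α) y))

theorem entry_integral_rankOne (hv : MemLp v 2 μ) :
    entry (∫ α, InnerProductSpace.rankOne ℂ (v α) (v α) ∂μ) = secondMoment μ v := by
  ext a b
  refine (inner_integral_rankOne hv (ket a) (ket b)).trans
    (integral_congr_ae (ae_of_all _ fun α => ?_))
  exact (InnerProductSpace.inner_right_rankOne_apply ..).symm.trans (entry_rankOne ..)

theorem isHSMatrix_secondMoment (hv : MemLp v 2 μ) : IsHSMatrix (secondMoment μ v) := by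
  have h_int : Integrable (fun α => tensorVec (v α) (star (v α))) μ := by
    refine (integrable_norm_mul_norm hv hv).mono' ?_
      (ae_of_all _ fun α => by rw [norm_tensorVec, norm_star])
    exact continuous_tensorVec.comp_aestronglyMeasurable
      (hv.1.prodMk (continuous_star.comp_aestronglyMeasurable hv.1))
  refine (hasSum_normSq (∫ α, tensorVec (v α) (star (v α)) ∂μ)).summable.congr fun p => ?_
  rw [← inner_ket, ← integral_inner h_int]
  simp only [inner_ket]
  rfl

theorem hasSum_integral_coord_mul_star_coord [Countable ι] (hv : MemLp v 2 μ)
    (hw : MemLp w 2 μ) :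
    HasSum (fun a => ∫ α, v α a * star (w α a) ∂μ) (∫ α, ⟪w α, v α⟫_ℂ ∂μ) := by
  have h_sum (α : Ω) := (hasSum_normSq (v α)).add (hasSum_normSq (w α))
  refine hasSum_integral_of_dominated_convergence (fun a α => ‖v α a‖ ^ 2 + ‖w α a‖ ^ 2)
    (fun a => (integrable_coord_mul_star_coord hv hw a a).1)
    (fun a => ae_of_all _ fun α => ?_) (ae_of_all _ fun α => (h_sum α).summable) ?_
    (ae_of_all _ fun α => by simpa using lp.hasSum_inner (𝕜 := ℂ) (w α) (v α))
  · rw [norm_mul, norm_star]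
    nlinarith [sq_nonneg (‖v α a‖ - ‖w α a‖), sq_nonneg (‖v α a‖), sq_nonneg (‖w α a‖)]
  · simp only [(h_sum _).tsum_eq]
    exact hv.norm.integrable_sq.add hw.norm.integrable_sq

theorem posSemidef_integral {F : Ω → Matrix ι ι ℂ} (hF : ∀ α, (F α).PosSemidef)
    (h_int : ∀ a b, Integrable (fun α => F α a b) μ) :
    (Matrix.of fun a b => ∫ α, F α a b ∂μ).PosSemidef := by
  refine posSemidef_iff_sum.2 fun s v => ?_
  have h_int' (a b : ι) := ((h_int a b).const_mul (star (v a))).mul_const (v b)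
  have h_nonneg : 0 ≤ ∫ α, ∑ a ∈ s, ∑ b ∈ s, star (v a) * F α a b * v b ∂μ :=
    integral_nonneg fun α => posSemidef_iff_sum.1 (hF α) s v
  refine h_nonneg.trans_eq ?_
  rw [integral_finsetSum _ fun a _ => integrable_finsetSum _ fun b _ => h_int' a b]
  refine Finset.sum_congr rfl fun a _ => ?_
  rw [integral_finsetSum _ fun b _ => h_int' a b]
  refine Finset.sum_congr rfl fun b _ => ?_
  rw [integral_mul_const, integral_const_mul, Matrix.of_apply]

end SecondMoment

section Ensemble

variable {Ω : Type*} [MeasurableSpace Ω] {ι κ : Type} (E : Ensemble Ω ι)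
  (U : Hilb ι →ₗᵢ[ℂ] Hilb κ)

instance Ensemble.isProbabilityMeasure : IsProbabilityMeasure E.μ := E.isProb

/-- The vector `ψ_α^* ⊗ U ψ_α`; the operator `R` is the average of the projections onto these
vectors. -/
def Rvec (α : Ω) : Hilb (ι × κ) := tensorVec (star (E.ψ α)) (U (E.ψ α))

theorem Rvec_apply (α : Ω) (p : ι × κ) :
    Rvec E U α p = star (E.ψ α p.1) * U (E.ψ α) p.2 := rfl

theorem norm_Rvec (α : Ω) : ‖Rvec E U α‖ = 1 := by
  rw [Rvec, norm_tensorVec, norm_star, U.norm_map, E.norm_one, one_mul]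

theorem Ensemble.memLp_star : MemLp (fun α => star (E.ψ α)) 2 E.μ :=
  .of_bound (continuous_star.comp_aestronglyMeasurable E.meas) 1
    (ae_of_all _ fun α => by rw [norm_star, E.norm_one])

theorem memLp_Rvec : MemLp (Rvec E U) 2 E.μ :=
  .of_bound (continuous_tensorVec.comp_aestronglyMeasurable
    ((continuous_star.comp_aestronglyMeasurable E.meas).prodMk
      (U.continuous.comp_aestronglyMeasurable E.meas))) 1
    (ae_of_all _ fun α => (norm_Rvec E U α).le)

theorem entry_Rop : entry (Rop E U) = secondMoment E.μ (Rvec E U) :=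
  entry_integral_rankOne (memLp_Rvec E U)

theorem hasSum_entry_Rop [Countable κ] (a b : ι) :
    HasSum (fun c => entry (Rop E U) (a, c) (b, c))
      (secondMoment E.μ (fun α => star (E.ψ α)) a b) := by
  have h_memLp (a : ι) : MemLp (fun α => star (E.ψ α a) • U (E.ψ α)) 2 E.μ :=
    .of_bound ((continuous_star.comp_aestronglyMeasurable
      ((continuous_coord a).comp_aestronglyMeasurable E.meas)).smul
        (U.continuous.comp_aestronglyMeasurable E.meas)) 1 (ae_of_all _ fun α => by
      rw [norm_smul, norm_star, U.norm_map, E.norm_one, mul_one, ← E.norm_one α]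
      exact norm_coord_le _ a)
  have h_sum := hasSum_integral_coord_mul_star_coord (h_memLp a) (h_memLp b)
  simpa [entry_Rop, secondMoment, Rvec_apply, inner_smul_left, inner_smul_right,
    inner_self_eq_norm_sq_to_K, E.norm_one] using h_sum

theorem entry_partialTrace_Rop [Countable κ] :
    entry (partialTrace (Rop E U)) = secondMoment E.μ fun α => star (E.ψ α) := by
  have h_matrix : (Matrix.of fun a b => ∑' c, entry (Rop E U) (a, c) (b, c)) =
      secondMoment E.μ fun α => star (E.ψ α) := by
    ext a b
    exact (hasSum_entry_Rop E U a b).tsum_eq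
  rw [partialTrace, h_matrix, entry_ofMatrix (isHSMatrix_secondMoment E.memLp_star)]

end Ensemble

section PartialTransposeRop

variable {Ω : Type*} [MeasurableSpace Ω] {n : ℕ} {I I' : Fin n → Type}
  (E : Ensemble Ω (∀ j, I j)) (U : Hilb (∀ j, I j) →ₗᵢ[ℂ] Hilb (∀ j, I' j)) (J : Finset (Fin n))

theorem entry_partialTranspose₂_Rop :
    entry (partialTranspose₂ J (Rop E U)) = ptMatrix₂ J (secondMoment E.μ (Rvec E U)) := by
  rw [partialTranspose₂, entry_Rop,
    entry_ofMatrix ((isHSMatrix_secondMoment (memLp_Rvec E U)).ptMatrix₂ J)]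

theorem entry_partialTranspose_partialTrace_Rop [∀ j, Countable (I' j)] :
    entry (partialTranspose J (partialTrace (Rop E U))) =
      ptMatrix J (secondMoment E.μ fun α => star (E.ψ α)) := by
  rw [partialTranspose, entry_partialTrace_Rop,
    entry_ofMatrix ((isHSMatrix_secondMoment E.memLp_star).ptMatrix J)]

end PartialTransposeRop

section Trace

variable {ι κ : Type}

theorem tr_comp_rankOne (X : Op ι) (u w : Hilb ι) :
    tr (X ∘L InnerProductSpace.rankOne ℂ u w) = ⟪w, X u⟫_ℂ := by
  refine ((lp.hasSum_inner (𝕜 := ℂ) w (X u)).congr_fun fun a => ?_).tsum_eq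
  rw [entry_apply, ContinuousLinearMap.comp_apply, InnerProductSpace.rankOne_apply, map_smul,
    lp.coeFn_smul, Pi.smul_apply, ← inner_conj_symm, inner_ket, smul_eq_mul, RCLike.inner_apply,
    mul_comm]

theorem tr_ketbra_ket [DecidableEq ι] (a b : ι) :
    tr (ketbra (ket a) (ket b) : Op ι) = (1 : Matrix ι ι ℂ) b a := by
  refine (tr_comp_rankOne (1 : Op ι) (ket a) (ket b)).trans ?_
  rw [one_apply_eq_self, inner_ket, ket_apply, Matrix.one_apply]

theorem IsTP.hasSum_ptMatrix₂_choi {n : ℕ} {I I' : Fin n → Type} [DecidableEq (∀ j, I j)]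
    {Λ : TC (∀ j, I j) →ₗ[ℂ] TC (∀ j, I' j)} (hΛ : IsTP Λ) (J : Finset (Fin n))
    (a b : ∀ j, I j) :
    HasSum (fun c => ptMatrix₂ J (choi Λ) (a, c) (b, c)) ((1 : Matrix _ _ ℂ) a b) := by
  have h_iff : J.piecewise a b = J.piecewise b a ↔ a = b := by
    refine ⟨fun h => funext fun j => ?_, fun h => by rw [h]⟩
    by_cases hj : j ∈ J <;> simpa [hj, eq_comm] using congrFun h j
  have h_sum := hasSum_tr (Λ (ketbra (ket (J.piecewise b a)) (ket (J.piecewise a b))))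
  have h_tr := hΛ (ketbra (ket (J.piecewise b a)) (ket (J.piecewise a b)))
  rw [tr_ketbra_ket, Matrix.one_apply, if_congr h_iff rfl rfl, ← Matrix.one_apply] at h_tr
  rw [← h_tr]
  simpa only [ptMatrix₂, choi, Matrix.of_apply, Finset.piecewise_same] using h_sum

theorem trMul_entry_tensorOne (X : Op ι) (B : Matrix (ι × κ) (ι × κ) ℂ) (s : Finset ι)
    (t : Finset κ) : trMul (s ×ˢ t) (entry (tensorOne κ X)) B =
      trMul s (entry X) (Matrix.of fun a b => ∑ c ∈ t, B (a, c) (b, c)) := by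
  classical
  simp only [trMul, Finset.sum_product, entry_tensorOne, Matrix.of_apply, Finset.mul_sum, ite_mul,
    zero_mul]
  refine Finset.sum_congr rfl fun a _ => ?_
  rw [Finset.sum_comm]
  refine Finset.sum_congr rfl fun b _ => Finset.sum_congr rfl fun c hc => ?_
  rw [Finset.sum_ite_eq, if_pos hc]

theorem posSemidef_one_sub_sum [DecidableEq ι] {C : Matrix (ι × κ) (ι × κ) ℂ}
    (hC : C.PosSemidef)
    (h_sum : ∀ a b, HasSum (fun c => C (a, c) (b, c)) ((1 : Matrix ι ι ℂ) a b)) (t : Finset κ) :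
    (1 - Matrix.of fun a b => ∑ c ∈ t, C (a, c) (b, c) : Matrix ι ι ℂ).PosSemidef :=
  posSemidef_of_hasSum (fun c : {c // c ∉ t} => hC.submatrix fun a => (a, c.1)) fun a b =>
    (t.hasSum_iff_compl.1 (h_sum a b))

theorem trMul_entry_tensorOne_le_one [DecidableEq ι] {ξ : Op ι} (hξ : IsState ξ)
    {C : Matrix (ι × κ) (ι × κ) ℂ} (hC : C.PosSemidef)
    (h_sum : ∀ a b, HasSum (fun c => C (a, c) (b, c)) ((1 : Matrix ι ι ℂ) a b))
    (s : Finset ι) (t : Finset κ) : trMul (s ×ˢ t) (entry (tensorOne κ ξ)) C ≤ 1 := by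
  have h_pos := posSemidef_entry_iff.2 hξ.1
  have h_nonneg := trMul_nonneg h_pos (posSemidef_one_sub_sum hC h_sum t) s
  have h_sub : trMul s (entry ξ) (1 - Matrix.of fun a b => ∑ c ∈ t, C (a, c) (b, c)) =
      ∑ a ∈ s, entry ξ a a - trMul (s ×ˢ t) (entry (tensorOne κ ξ)) C := by
    rw [trMul_entry_tensorOne]
    simp only [trMul, Matrix.sub_apply, mul_sub, Finset.sum_sub_distrib, Matrix.one_apply, mul_ite,
      mul_one, mul_zero, Finset.sum_ite_eq', sub_left_inj]
    exact Finset.sum_congr rfl fun a ha => if_pos ha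
  rw [h_sub, sub_nonneg] at h_nonneg
  exact h_nonneg.trans (sum_le_hasSum s (fun a _ => h_pos.diag_nonneg) hξ.2)

end Trace

section Fidelity

variable {Ω : Type*} [MeasurableSpace Ω] {μ : Measure Ω} {ι κ : Type}

theorem lintegral_ofReal_le_of_tendsto {β : Type*} {l : Filter β} [l.NeBot]
    [l.IsCountablyGenerated] {f : β → Ω → ℝ} {g : Ω → ℝ} {c : ℝ≥0∞}
    (hf : ∀ x, AEMeasurable (f x) μ) (hfg : ∀ α, Tendsto (fun x => f x α) l (𝓝 (g α)))
    (hc : ∀ x, ∫⁻ α, ENNReal.ofReal (f x α) ∂μ ≤ c) : ∫⁻ α, ENNReal.ofReal (g α) ∂μ ≤ c :=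
  calc ∫⁻ α, ENNReal.ofReal (g α) ∂μ
      = ∫⁻ α, liminf (fun x => ENNReal.ofReal (f x α)) l ∂μ :=
        lintegral_congr fun α => ((ENNReal.continuous_ofReal.tendsto _).comp (hfg α)).liminf_eq.symm
    _ ≤ liminf (fun x => ∫⁻ α, ENNReal.ofReal (f x α) ∂μ) l :=
        lintegral_liminf_le' fun x => (hf x).ennreal_ofReal
    _ ≤ liminf (fun _ => c) l := liminf_le_liminf (Eventually.of_forall hc)
    _ = c := tendsto_const_nhds.liminf_eq

section IntegralTrMul

variable {v : Ω → Hilb ι}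

theorem integrable_trMul (hv : MemLp v 2 μ) (s : Finset ι) (B : Matrix ι ι ℂ) : Integrable
    (fun α => trMul s (Matrix.of fun a b => v α a * star (v α b)) B) μ :=
  integrable_finsetSum _ fun a _ => integrable_finsetSum _ fun b _ =>
    (integrable_coord_mul_star_coord hv hv a b).mul_const _

theorem integral_trMul (hv : MemLp v 2 μ) (s : Finset ι) (B : Matrix ι ι ℂ) :
    ∫ α, trMul s (Matrix.of fun a b => v α a * star (v α b)) B ∂μ =
      trMul s (secondMoment μ v) B := by
  have h_int (a b : ι) := (integrable_coord_mul_star_coord hv hv a b).mul_const (B b a)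
  simp only [trMul, Matrix.of_apply]
  rw [integral_finsetSum _ fun a _ => integrable_finsetSum _ fun b _ => h_int a b]
  refine Finset.sum_congr rfl fun a _ => ?_
  rw [integral_finsetSum _ fun b _ => h_int a b]
  simp only [integral_mul_const, secondMoment, Matrix.of_apply]

theorem lintegral_ofReal_re_trMul (hv : MemLp v 2 μ) (s : Finset ι) {B : Matrix ι ι ℂ}
    (hB : B.PosSemidef) :
    ∫⁻ α, ENNReal.ofReal (trMul s (Matrix.of fun a b => v α a * star (v α b)) B).re ∂μ =
      ENNReal.ofReal (trMul s (secondMoment μ v) B).re := by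
  have h_int := integrable_trMul hv s B
  rw [← integral_trMul hv]
  exact (ofReal_integral_eq_lintegral_ofReal h_int.re (ae_of_all _ fun α =>
    (Complex.nonneg_iff.1 (trMul_nonneg (posSemidef_mul_star (v α)) hB s)).1)).symm.trans
    (congrArg _ (integral_re h_int))

end IntegralTrMul

theorem tendsto_trMul_choi (Λ : TC ι →ₗ[ℂ] TC κ) (x : Hilb ι) (u : Hilb κ) (s : Finset ι) :
    Tendsto (fun t : Finset κ => trMul (s ×ˢ t) (Matrix.of fun p q =>
        tensorVec (star x) u p * star (tensorVec (star x) u q)) (choi Λ)) atTop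
      (𝓝 ⟪u, (Λ (trunc s (InnerProductSpace.rankOne ℂ x x)) : Op κ) u⟫_ℂ) := by
  have h_entry (c d : κ) :
      entry (Λ (trunc s (InnerProductSpace.rankOne ℂ x x)) : Op κ) c d =
        ∑ a ∈ s, ∑ b ∈ s, x a * star (x b) * choi Λ (a, c) (b, d) := by
    simp only [entry_apply _ c d, trunc, choi, entry_rankOne, LinearMap.coe_mk, AddHom.coe_mk,
      map_sum, map_smul, Submodule.coe_sum, Submodule.coe_smul, sum_apply, smul_apply,
      lp.coeFn_sum, lp.coeFn_smul, Finset.sum_apply, Pi.smul_apply, smul_eq_mul, Matrix.of_apply]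
  refine (tendsto_sum_entry_inner _ u u).congr fun t => ?_
  rw [trMul, Finset.sum_comm, Finset.sum_product_right]
  refine Finset.sum_congr rfl fun c _ => ?_
  simp only [Finset.sum_product_right _ t]
  rw [Finset.sum_comm]
  refine Finset.sum_congr rfl fun d _ => ?_
  simp only [h_entry, Finset.mul_sum, Finset.sum_mul]
  rw [Finset.sum_comm]
  refine Finset.sum_congr rfl fun a _ => Finset.sum_congr rfl fun b _ => ?_
  simp only [tensorVec, Matrix.of_apply, lp.star_apply, star_mul, star_star]
  ring

variable (E : Ensemble Ω ι) (U : Hilb ι →ₗᵢ[ℂ] Hilb κ)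

theorem avgFidelity_eq (Λ : TC ι →ₗ[ℂ] TC κ) :
    avgFidelity E U Λ = ∫⁻ α, ENNReal.ofReal
      (⟪U (E.ψ α), (Λ (ketbra (E.ψ α) (E.ψ α)) : Op κ) (U (E.ψ α))⟫_ℂ).re ∂E.μ :=
  lintegral_congr fun _ => by rw [← tr_comp_rankOne]; rfl

theorem avgFidelity_le_of_trMul_le [Countable ι] [Countable κ] {Λ : TC ι →ₗ[ℂ] TC κ}
    (hΛ : IsChannel Λ) {S : Finset ι → Finset ι} {T : Finset κ → Finset κ}
    (hS : Tendsto S atTop atTop) (hT : Tendsto T atTop atTop) {c : ℝ}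
    (h : ∀ s t, (trMul (S s ×ˢ T t) (entry (Rop E U)) (choi Λ)).re ≤ c) :
    avgFidelity E U Λ ≤ ENNReal.ofReal c := by
  let f (s : Finset ι) (t : Finset κ) (α : Ω) : ℝ := (trMul (S s ×ˢ T t)
    (Matrix.of fun p q => Rvec E U α p * star (Rvec E U α q)) (choi Λ)).re
  let g (s : Finset ι) (α : Ω) : ℝ := (⟪U (E.ψ α),
    (Λ (trunc (S s) (InnerProductSpace.rankOne ℂ (E.ψ α) (E.ψ α))) : Op κ) (U (E.ψ α))⟫_ℂ).re
  have hf (s t) : AEMeasurable (f s t) E.μ :=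
    (integrable_trMul (memLp_Rvec E U) _ _).re.aemeasurable
  have hfg (s α) : Tendsto (fun t => f s t α) atTop (𝓝 (g s α)) :=
    (Complex.continuous_re.tendsto _).comp
      ((tendsto_trMul_choi Λ (E.ψ α) (U (E.ψ α)) (S s)).comp hT)
  have hg (s) : AEMeasurable (g s) E.μ :=
    aemeasurable_of_tendsto_metrizable_ae atTop (hf s) (ae_of_all _ (hfg s))
  rw [avgFidelity_eq]
  refine lintegral_ofReal_le_of_tendsto (l := atTop) hg (fun α => ?_) fun s =>
    lintegral_ofReal_le_of_tendsto (l := atTop) (hf s) (hfg s) fun t => ?_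
  · exact (Complex.continuous_re.tendsto _).comp
      ((hΛ.tendsto_trunc (ketbra (E.ψ α) (E.ψ α)) _ _).comp hS)
  · rw [lintegral_ofReal_re_trMul (memLp_Rvec E U) _ hΛ.1.choi_posSemidef, ← entry_Rop]
    exact ENNReal.ofReal_le_ofReal (h s t)

end Fidelity

section MainBound

variable {n : ℕ} {I I' : Fin n → Type}

theorem trMul_choi_le {Λ : TC (∀ j, I j) →ₗ[ℂ] TC (∀ j, I' j)} (hΛ : IsTP Λ)
    {J : Finset (Fin n)} (hJ : (ptMatrix₂ J (choi Λ)).PosSemidef) {κ : ℝ} (hκ : 0 ≤ κ)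
    {ξ : Op (∀ j, I j)} (hξ : IsState ξ)
    {M : Matrix ((∀ j, I j) × (∀ j, I' j)) ((∀ j, I j) × (∀ j, I' j)) ℂ}
    (hM : ((κ : ℂ) • entry (tensorOne (∀ j, I' j) ξ) - ptMatrix₂ J M).PosSemidef)
    (S : ∀ j, Finset (I j)) (T : ∀ j, Finset (I' j)) :
    trMul (Fintype.piFinset S ×ˢ Fintype.piFinset T) M (choi Λ) ≤ κ := by
  classical
  calc trMul (Fintype.piFinset S ×ˢ Fintype.piFinset T) M (choi Λ)
      = trMul (Fintype.piFinset S ×ˢ Fintype.piFinset T) (ptMatrix₂ J M)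
          (ptMatrix₂ J (choi Λ)) := (trMul_ptMatrix₂ J S T _ _).symm
    _ ≤ κ * trMul (Fintype.piFinset S ×ˢ Fintype.piFinset T)
          (entry (tensorOne (∀ j, I' j) ξ)) (ptMatrix₂ J (choi Λ)) := by
        rw [← sub_nonneg, ← trMul_smul_left, ← trMul_sub_left]
        exact trMul_nonneg hM hJ _
    _ ≤ κ := mul_le_of_le_one_right (Complex.zero_le_real.2 hκ)
        (trMul_entry_tensorOne_le_one hξ hJ (hΛ.hasSum_ptMatrix₂_choi J) _ _)

theorem avgFidelity_le {Ω : Type*} [MeasurableSpace Ω] [∀ j, Countable (I j)]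
    [∀ j, Countable (I' j)] (E : Ensemble Ω (∀ j, I j))
    (U : Hilb (∀ j, I j) →ₗᵢ[ℂ] Hilb (∀ j, I' j))
    {Λ : TC (∀ j, I j) →ₗ[ℂ] TC (∀ j, I' j)} (hΛ : IsChannel Λ) {J : Finset (Fin n)}
    (hJ : (ptMatrix₂ J (choi Λ)).PosSemidef) {κ : ℝ} (hκ : 0 ≤ κ) {ξ : Op (∀ j, I j)}
    (hξ : IsState ξ)
    (hle : partialTranspose₂ J (Rop E U) ≤ (κ : ℂ) • tensorOne (∀ j, I' j) ξ) :
    avgFidelity E U Λ ≤ ENNReal.ofReal κ := by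
  rw [le_iff_posSemidef_entry, entry_partialTranspose₂_Rop, entry_smul, ← entry_Rop] at hle
  exact avgFidelity_le_of_trMul_le E U hΛ tendsto_piFinset_boxSides tendsto_piFinset_boxSides
    fun s t => (Complex.le_def.1
      (trMul_choi_le hΛ.2 hJ hκ hξ hle (boxSides s) (boxSides t))).1

end MainBound

section MaxRelativeEntropy

variable {ι κ : Type}

theorem smul_le_smul_of_isPositive {Y : Op ι} (hY : Y.IsPositive) {k l : ℝ} (h : k ≤ l) :
    (k : ℂ) • Y ≤ (l : ℂ) • Y := by
  rw [ContinuousLinearMap.le_def, ← sub_smul, ← Complex.ofReal_sub]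
  exact hY.smul_of_nonneg (Complex.zero_le_real.2 (sub_nonneg.2 h))

theorem iInf_dmax_tensorOne_eq (X : Op (ι × κ)) :
    (⨅ (ξ : Op ι) (_ : IsState ξ), dmax X (tensorOne κ ξ)) =
      ⨅ (k : ℝ) (_ : 0 ≤ k ∧ ∃ ξ : Op ι, IsState ξ ∧ X ≤ (k : ℂ) • tensorOne κ ξ),
        ENNReal.ofReal k := by
  refine le_antisymm (le_iInf₂ ?_) (le_iInf₂ fun ξ hξ => le_iInf₂ fun l hl =>
    iInf₂_le l ⟨hl.1.le, ξ, hξ, hl.2⟩)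
  rintro k ⟨hk, ξ, hξ, hle⟩
  refine iInf₂_le_of_le ξ hξ (ENNReal.le_of_forall_pos_le_add fun ε hε _ => ?_)
  have h_pos : 0 < k + ε := add_pos_of_nonneg_of_pos hk hε
  have h_le : (k : ℂ) • tensorOne κ ξ ≤ ((k + ε : ℝ) : ℂ) • tensorOne κ ξ :=
    smul_le_smul_of_isPositive (tensorOne_isPositive hξ.1) (le_add_of_nonneg_right ε.coe_nonneg)
  refine iInf₂_le_of_le (k + ε) ⟨h_pos, hle.trans h_le⟩ ?_
  rw [ENNReal.ofReal_add hk ε.coe_nonneg, ENNReal.ofReal_coe_nnreal]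

theorem dmax_eq_of_transpose {X X' Y Y' : Op ι} (hX : entry X' = (entry X).transpose)
    (hY : entry Y' = (entry Y).transpose) : dmax X' Y' = dmax X Y := by
  have h_iff (l : ℝ) : X' ≤ (l : ℂ) • Y' ↔ X ≤ (l : ℂ) • Y := by
    rw [le_iff_posSemidef_entry, le_iff_posSemidef_entry, entry_smul, entry_smul, hX, hY,
      ← Matrix.transpose_smul, ← Matrix.transpose_sub, Matrix.posSemidef_transpose_iff]
  simp only [dmax, h_iff]

end MaxRelativeEntropy

section TrivialBound

variable {ι κ : Type}

theorem inner_tensorVec (u u' : Hilb ι) (w w' : Hilb κ) :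
    ⟪tensorVec u w, tensorVec u' w'⟫_ℂ = ⟪u, u'⟫_ℂ * ⟪w, w'⟫_ℂ := by
  have h_sum := lp.hasSum_inner (𝕜 := ℂ) (tensorVec u w) (tensorVec u' w')
  have h_mul (p : ι × κ) : ⟪tensorVec u w p, tensorVec u' w' p⟫_ℂ =
      ⟪u p.1, u' p.1⟫_ℂ * ⟪w p.2, w' p.2⟫_ℂ := by
    simp only [tensorVec, RCLike.inner_apply, map_mul]
    ring
  have h_prod := (lp.hasSum_inner (𝕜 := ℂ) u u').mul (lp.hasSum_inner (𝕜 := ℂ) w w')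
    (h_sum.summable.congr h_mul)
  exact h_sum.unique (h_prod.congr_fun h_mul)

theorem tensorOne_tensorVec (X : Op ι) (u : Hilb ι) (w : Hilb κ) :
    tensorOne κ X (tensorVec u w) = tensorVec (X u) w := by
  ext ⟨a, c⟩
  have h_slice : slice c (tensorVec u w) = w c • u := by
    ext b
    exact mul_comm _ _
  change ⟪ket a, X (slice c (tensorVec u w))⟫_ℂ = X u a * w c
  rw [h_slice, map_smul, inner_smul_right, inner_ket, mul_comm]

/-- The vector `∑ a ∈ s, |a⟩ ⊗ U|a⟩`, an unnormalised maximally entangled vector truncated to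
finitely many basis vectors. -/
def entangledVec (U : Hilb ι →ₗᵢ[ℂ] Hilb κ) (s : Finset ι) : Hilb (ι × κ) :=
  ∑ a ∈ s, tensorVec (ket a) (U (ket a))

theorem inner_entangledVec_tensorVec (U : Hilb ι →ₗᵢ[ℂ] Hilb κ) (s : Finset ι) (x : Hilb ι) :
    ⟪entangledVec U s, tensorVec (star x) (U x)⟫_ℂ = ((∑ a ∈ s, ‖x a‖ ^ 2 : ℝ) : ℂ) := by
  simp only [entangledVec, sum_inner, inner_tensorVec, U.inner_map_map, inner_ket, lp.star_apply,
    Complex.ofReal_sum, Complex.ofReal_pow]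
  exact Finset.sum_congr rfl fun a _ => Complex.conj_mul' (x a)

theorem inner_tensorOne_entangledVec (U : Hilb ι →ₗᵢ[ℂ] Hilb κ) (s : Finset ι) (X : Op ι) :
    ⟪entangledVec U s, tensorOne κ X (entangledVec U s)⟫_ℂ = ∑ a ∈ s, entry X a a := by
  classical
  simp only [entangledVec, map_sum, sum_inner, inner_sum, tensorOne_tensorVec, inner_tensorVec,
    U.inner_map_map, inner_ket, ket_apply, mul_ite, mul_one, mul_zero]
  refine Finset.sum_congr rfl fun a ha => ?_
  rw [Finset.sum_ite_eq', if_pos ha, entry_apply]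

variable {Ω : Type*} [MeasurableSpace Ω] (E : Ensemble Ω ι) (U : Hilb ι →ₗᵢ[ℂ] Hilb κ)

theorem lintegral_sum_norm_sq_sq_eq (s : Finset ι) :
    ∫⁻ α, ENNReal.ofReal ((∑ a ∈ s, ‖E.ψ α a‖ ^ 2) ^ 2) ∂E.μ =
      ENNReal.ofReal (⟪entangledVec U s, Rop E U (entangledVec U s)⟫_ℂ).re := by
  have h_inner (α : Ω) : ⟪entangledVec U s, Rvec E U α⟫_ℂ * ⟪Rvec E U α, entangledVec U s⟫_ℂ =
      (((∑ a ∈ s, ‖E.ψ α a‖ ^ 2) ^ 2 : ℝ) : ℂ) := by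
    rw [← inner_conj_symm (Rvec E U α), Rvec, inner_entangledVec_tensorVec, Complex.conj_ofReal,
      ← Complex.ofReal_mul, ← sq]
  have h_int : Integrable (fun α => (∑ a ∈ s, ‖E.ψ α a‖ ^ 2) ^ 2) E.μ := by
    have h_memLp := (memLp_Rvec E U).const_inner (𝕜 := ℂ) (entangledVec U s)
    refine h_memLp.norm.integrable_sq.congr (ae_of_all _ fun α => ?_)
    change ‖⟪_, tensorVec _ _⟫_ℂ‖ ^ 2 = _
    rw [inner_entangledVec_tensorVec, Complex.norm_real, Real.norm_eq_abs, sq_abs]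
  have h_Rop : ⟪entangledVec U s, Rop E U (entangledVec U s)⟫_ℂ =
      ((∫ α, (∑ a ∈ s, ‖E.ψ α a‖ ^ 2) ^ 2 ∂E.μ : ℝ) : ℂ) :=
    (inner_integral_rankOne (memLp_Rvec E U) _ _).trans
      ((integral_congr_ae (ae_of_all _ h_inner)).trans integral_complex_ofReal)
  rw [h_Rop, Complex.ofReal_re,
    ofReal_integral_eq_lintegral_ofReal h_int (ae_of_all _ fun α => by positivity)]

theorem one_le_of_Rop_le [Countable ι] {k : ℝ} (hk : 0 ≤ k) {ξ : Op ι} (hξ : IsState ξ)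
    (hle : Rop E U ≤ (k : ℂ) • tensorOne κ ξ) : 1 ≤ k := by
  have h_trace (s : Finset ι) : (∑ a ∈ s, entry ξ a a) ≤ 1 :=
    sum_le_hasSum s (fun _ _ => (posSemidef_entry_iff.2 hξ.1).diag_nonneg) hξ.2
  have h_inner (s : Finset ι) : ⟪entangledVec U s, Rop E U (entangledVec U s)⟫_ℂ ≤ k := by
    have h_nonneg := ((ContinuousLinearMap.le_def _ _).1 hle).inner_nonneg_right (entangledVec U s)
    rw [sub_apply, smul_apply, inner_sub_right, inner_smul_right, inner_tensorOne_entangledVec,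
      sub_nonneg] at h_nonneg
    exact h_nonneg.trans (mul_le_of_le_one_right (Complex.zero_le_real.2 hk) (h_trace s))
  have h_tendsto (α : Ω) :
      Tendsto (fun s => (∑ a ∈ s, ‖E.ψ α a‖ ^ 2) ^ 2) atTop (𝓝 1) := by
    simpa [E.norm_one] using (hasSum_normSq (E.ψ α)).pow 2
  have h_coord (a : ι) : AEMeasurable (fun α => ‖E.ψ α a‖ ^ 2) E.μ :=
    ((continuous_coord a).comp_aestronglyMeasurable E.meas).norm.aemeasurable.pow_const 2
  have h_lintegral := lintegral_ofReal_le_of_tendsto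
    (fun s => (Finset.aemeasurable_fun_sum s fun a _ => h_coord a).pow_const 2) h_tendsto
    fun s => (lintegral_sum_norm_sq_sq_eq E U s).trans_le
      (ENNReal.ofReal_le_ofReal (Complex.le_def.1 (h_inner s)).1)
  simpa using h_lintegral

end TrivialBound

section HilbertSchmidtNormLeOne

variable {ι : Type*}

theorem norm_sum_sum_star_mul_mul_sq_le (M : Matrix ι ι ℂ) (s : Finset ι) (v : ι → ℂ) :
    ‖∑ a ∈ s, ∑ b ∈ s, star (v a) * M a b * v b‖ ^ 2 ≤
      (∑ p ∈ s ×ˢ s, ‖M p.1 p.2‖ ^ 2) * (∑ a ∈ s, ‖v a‖ ^ 2) ^ 2 := by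
  have h_triangle : ‖∑ a ∈ s, ∑ b ∈ s, star (v a) * M a b * v b‖ ≤
      ∑ p ∈ s ×ˢ s, ‖M p.1 p.2‖ * (‖v p.1‖ * ‖v p.2‖) := by
    rw [← Finset.sum_product']
    refine (norm_sum_le _ _).trans_eq (Finset.sum_congr rfl fun p _ => ?_)
    rw [norm_mul, norm_mul, norm_star]
    ring
  have h_norm_sq : ∑ p ∈ s ×ˢ s, (‖v p.1‖ * ‖v p.2‖) ^ 2 = (∑ a ∈ s, ‖v a‖ ^ 2) ^ 2 := by
    simp only [mul_pow]
    rw [sq (∑ a ∈ s, ‖v a‖ ^ 2), Finset.sum_mul_sum, ← Finset.sum_product']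
  rw [← h_norm_sq]
  exact (pow_le_pow_left₀ (norm_nonneg _) h_triangle 2).trans
    (Finset.sum_mul_sq_le_sq_mul_sq (s ×ˢ s) _ _)

theorem posSemidef_one_sub [DecidableEq ι] {M : Matrix ι ι ℂ} (hM : M.IsHermitian)
    (h_norm : ∀ t : Finset (ι × ι), ∑ p ∈ t, ‖M p.1 p.2‖ ^ 2 ≤ 1) : (1 - M).PosSemidef := by
  refine posSemidef_iff_sum.2 fun s v => ?_
  have h_one : ∑ a ∈ s, ∑ b ∈ s, star (v a) * (1 : Matrix ι ι ℂ) a b * v b =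
      ((∑ a ∈ s, ‖v a‖ ^ 2 : ℝ) : ℂ) := by
    simp only [Matrix.one_apply, mul_ite, ite_mul, mul_one, mul_zero, zero_mul, Complex.ofReal_sum,
      Complex.ofReal_pow]
    refine Finset.sum_congr rfl fun a ha => ?_
    rw [Finset.sum_ite_eq, if_pos ha]
    exact Complex.conj_mul' (v a)
  set z := ∑ a ∈ s, ∑ b ∈ s, star (v a) * M a b * v b with hz
  have h_real : star z = z := by
    rw [hz, star_sum, Finset.sum_comm]
    refine Finset.sum_congr rfl fun a _ => ?_
    rw [star_sum]
    refine Finset.sum_congr rfl fun b _ => ?_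
    rw [star_mul, star_mul, star_star, hM.apply, mul_assoc]
  have h_le : z.re ≤ ∑ a ∈ s, ‖v a‖ ^ 2 := by
    refine (Complex.re_le_norm z).trans (le_of_sq_le_sq ?_ (by positivity))
    exact (norm_sum_sum_star_mul_mul_sq_le M s v).trans
      (mul_le_of_le_one_left (by positivity) (h_norm _))
  simp only [Matrix.sub_apply, mul_sub, sub_mul, Finset.sum_sub_distrib]
  rw [h_one, ← hz, ← Complex.conj_eq_iff_re.1 h_real, ← Complex.ofReal_sub]
  exact Complex.zero_le_real.2 (sub_nonneg.2 h_le)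

end HilbertSchmidtNormLeOne

section PureStates

variable {n : ℕ} {I I' : Fin n → Type} (J : Finset (Fin n))

-- For a product state, transposing the party `j` replaces its factor by the complex conjugate.
theorem ptMatrix_prod_mul_star_posSemidef (φ : ∀ j, I j → ℂ) :
    (ptMatrix J
      (Matrix.of fun a b => (∏ j, φ j (a j)) * star (∏ j, φ j (b j)))).PosSemidef := by
  convert posSemidef_mul_star fun a : ∀ j, I j =>
    ∏ j, if j ∈ J then star (φ j (a j)) else φ j (a j) using 1
  ext a b
  simp only [ptMatrix, Matrix.of_apply, star_prod, ← Finset.prod_mul_distrib]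
  refine Finset.prod_congr rfl fun j _ => ?_
  by_cases hj : j ∈ J <;> simp [hj, mul_comm]

theorem posSemidef_one_sub_ptMatrix_mul_star [DecidableEq (∀ j, I j)] {u : Hilb (∀ j, I j)}
    (hu : ‖u‖ = 1) :
    (1 - ptMatrix J (Matrix.of fun a b => u a * star (u b))).PosSemidef := by
  refine posSemidef_one_sub ?_ fun t => ?_
  · ext a b
    simp only [ptMatrix, Matrix.conjTranspose_apply, Matrix.of_apply, star_mul', star_star,
      mul_comm]
  · have h_sum := (partialSwap J).hasSum_iff.2 (hasSum_normSq (tensorVec u (star u)))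
    rw [norm_tensorVec, norm_star, hu, mul_one, one_pow] at h_sum
    exact sum_le_hasSum t (fun _ _ => by positivity) h_sum

theorem ptMatrix₂_tensorVec_mul_star (x : Hilb (∀ j, I j)) (u : Hilb (∀ j, I' j)) :
    ptMatrix₂ J (Matrix.of fun p q => tensorVec x u p * star (tensorVec x u q)) =
      Matrix.of fun p q => ptMatrix J (Matrix.of fun a b => x a * star (x b)) p.1 q.1 *
        ptMatrix J (Matrix.of fun c d => u c * star (u d)) p.2 q.2 := by
  ext p q
  simp only [ptMatrix₂, ptMatrix, tensorVec, Matrix.of_apply, star_mul']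
  ring

end PureStates

section ProductEnsembles

variable {Ω : Type*} [MeasurableSpace Ω] {n : ℕ} {I I' : Fin n → Type}
  {E : Ensemble Ω (∀ j, I j)}

theorem Ensemble.IsProduct.ptMatrix_posSemidef (hE : E.IsProduct) (J : Finset (Fin n)) (α : Ω) :
    (ptMatrix J (Matrix.of fun a b => star (E.ψ α) a * star (star (E.ψ α) b))).PosSemidef := by
  obtain ⟨φ, -, hφ⟩ := hE α
  simpa only [lp.star_apply, hφ, star_prod] using
    ptMatrix_prod_mul_star_posSemidef J fun j a => star (φ j a)

theorem integrable_ptMatrix_mul_star {v : Ω → Hilb (∀ j, I j)} {μ : Measure Ω}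
    (hv : MemLp v 2 μ) (J : Finset (Fin n)) (a b : ∀ j, I j) :
    Integrable (fun α => ptMatrix J (Matrix.of fun a b => v α a * star (v α b)) a b) μ :=
  integrable_coord_mul_star_coord hv hv _ _

variable (U : Hilb (∀ j, I j) →ₗᵢ[ℂ] Hilb (∀ j, I' j))

theorem Ensemble.IsProduct.posSemidef_ptMatrix_mul_one_sub_ptMatrix₂ [DecidableEq (∀ j, I' j)]
    (hE : E.IsProduct) (J : Finset (Fin n)) (α : Ω) :
    (Matrix.of fun p q : (∀ j, I j) × (∀ j, I' j) =>
      ptMatrix J (Matrix.of fun a b => star (E.ψ α) a * star (star (E.ψ α) b)) p.1 q.1 *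
          (1 : Matrix _ _ ℂ) p.2 q.2 -
        ptMatrix₂ J (Matrix.of fun p q => Rvec E U α p * star (Rvec E U α q)) p q).PosSemidef := by
  have h_one_sub := posSemidef_one_sub_ptMatrix_mul_star J
    (show ‖U (E.ψ α)‖ = 1 by rw [U.norm_map, E.norm_one])
  refine (congrArg Matrix.PosSemidef ?_).mp
    (((hE.ptMatrix_posSemidef J α).submatrix Prod.fst).hadamard (h_one_sub.submatrix Prod.snd))
  ext p q
  simp only [Rvec, ptMatrix₂_tensorVec_mul_star, Matrix.of_apply, Matrix.hadamard_apply,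
    Matrix.submatrix_apply, Matrix.sub_apply, mul_sub]

variable [∀ j, Countable (I' j)]

theorem Ensemble.IsProduct.isState_partialTranspose_partialTrace_Rop [∀ j, Countable (I j)]
    (hE : E.IsProduct) (J : Finset (Fin n)) :
    IsState (partialTranspose J (partialTrace (Rop E U))) := by
  refine ⟨posSemidef_entry_iff.1 ?_, ?_⟩ <;> rw [entry_partialTranspose_partialTrace_Rop]
  · exact posSemidef_integral (hE.ptMatrix_posSemidef J)
      (integrable_ptMatrix_mul_star E.memLp_star J)
  · have h_sum := hasSum_integral_coord_mul_star_coord E.memLp_star E.memLp_star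
    simpa [ptMatrix, Finset.piecewise_same, secondMoment, inner_self_eq_norm_sq_to_K,
      E.norm_one] using h_sum

theorem Ensemble.IsProduct.partialTranspose₂_Rop_le (hE : E.IsProduct) (J : Finset (Fin n)) :
    partialTranspose₂ J (Rop E U) ≤
      tensorOne (∀ j, I' j) (partialTranspose J (partialTrace (Rop E U))) := by
  classical
  have h_int_one (p q : (∀ j, I j) × (∀ j, I' j)) :=
    (integrable_ptMatrix_mul_star E.memLp_star J p.1 q.1).mul_const
      ((1 : Matrix (∀ j, I' j) _ ℂ) p.2 q.2)
  have h_int_R (p q : (∀ j, I j) × (∀ j, I' j)) : Integrable (fun α =>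
      ptMatrix₂ J (Matrix.of fun p q => Rvec E U α p * star (Rvec E U α q)) p q) E.μ :=
    integrable_coord_mul_star_coord (memLp_Rvec E U) (memLp_Rvec E U) _ _
  rw [le_iff_posSemidef_entry, entry_partialTranspose₂_Rop]
  refine (congrArg Matrix.PosSemidef ?_).mp
    (posSemidef_integral (hE.posSemidef_ptMatrix_mul_one_sub_ptMatrix₂ U J)
      fun p q => (h_int_one p q).sub (h_int_R p q))
  ext ⟨a, c⟩ ⟨b, d⟩
  refine (integral_sub (h_int_one _ _) (h_int_R _ _)).trans ?_
  rw [integral_mul_const, Matrix.sub_apply, entry_tensorOne,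
    entry_partialTranspose_partialTrace_Rop, Matrix.one_apply, mul_ite, mul_one, mul_zero]
  rfl

end ProductEnsembles

section Bounds

variable {Ω : Type*} [MeasurableSpace Ω] {n : ℕ} {I I' : Fin n → Type}
  (E : Ensemble Ω (∀ j, I j)) (U : Hilb (∀ j, I j) →ₗᵢ[ℂ] Hilb (∀ j, I' j)) (J : Finset (Fin n))

theorem minEntropyBound_eq : minEntropyBound E U J =
    ⨅ (ξ : Op (∀ j, I j)) (_ : IsState ξ),
      dmax (partialTranspose₂ J (Rop E U)) (tensorOne (∀ j, I' j) ξ) := by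
  rw [minEntropyBound, Hmin, neg_neg, ENNReal.exp_log]

theorem entry_partialTranspose₂_Rop_compl :
    entry (partialTranspose₂ Jᶜ (Rop E U)) =
      (entry (partialTranspose₂ J (Rop E U))).transpose := by
  rw [entry_partialTranspose₂_Rop, entry_partialTranspose₂_Rop, ptMatrix₂_compl]

theorem minEntropyBound_compl_le : minEntropyBound E U Jᶜ ≤ minEntropyBound E U J := by
  rw [minEntropyBound_eq, minEntropyBound_eq]
  exact le_iInf₂ fun ξ hξ => iInf₂_le_of_le (conjOp ξ) hξ.conjOp
    (dmax_eq_of_transpose (entry_partialTranspose₂_Rop_compl E U J)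
      (entry_tensorOne_transpose (entry_conjOp_of_isPositive hξ.1))).le

theorem minEntropyBound_compl : minEntropyBound E U Jᶜ = minEntropyBound E U J :=
  (minEntropyBound_compl_le E U J).antisymm (by simpa using minEntropyBound_compl_le E U Jᶜ)

theorem pptFidelity_le_minEntropyBound [∀ j, Countable (I j)] [∀ j, Countable (I' j)] :
    pptFidelity E U ≤ minEntropyBound E U J := by
  rw [minEntropyBound_eq]
  exact iSup₂_le fun Λ hΛ => le_iInf₂ fun ξ hξ => le_iInf₂ fun l hl =>
    avgFidelity_le E U hΛ.1 (hΛ.2 J) hl.1.le hξ hl.2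

theorem one_le_minEntropyBound_empty [∀ j, Countable (I j)] : 1 ≤ minEntropyBound E U ∅ := by
  have h_Rop : partialTranspose₂ ∅ (Rop E U) = Rop E U :=
    entry_injective (by rw [entry_partialTranspose₂_Rop, ptMatrix₂_empty, entry_Rop])
  rw [minEntropyBound_eq, h_Rop]
  exact le_iInf₂ fun ξ hξ => le_iInf₂ fun l hl =>
    ENNReal.one_le_ofReal.2 (one_le_of_Rop_le E U hl.1.le hξ hl.2)

theorem productBound_compl [∀ j, Countable (I' j)] :
    productBound E U Jᶜ = productBound E U J := by
  refine dmax_eq_of_transpose (entry_partialTranspose₂_Rop_compl E U J)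
    (entry_tensorOne_transpose ?_)
  rw [entry_partialTranspose_partialTrace_Rop, entry_partialTranspose_partialTrace_Rop,
    ptMatrix_compl]

variable {E}

theorem minEntropyBound_le_productBound [∀ j, Countable (I j)] [∀ j, Countable (I' j)]
    (hE : E.IsProduct) : minEntropyBound E U J ≤ productBound E U J := by
  rw [minEntropyBound_eq]
  exact iInf₂_le _ (hE.isState_partialTranspose_partialTrace_Rop U J)

theorem productBound_le_one [∀ j, Countable (I' j)] (hE : E.IsProduct) :
    productBound E U J ≤ 1 :=
  iInf₂_le_of_le 1 ⟨one_pos, by simpa using hE.partialTranspose₂_Rop_le U J⟩ (by simp)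

end Bounds

section ComplementSymmetry

variable {σ R : Type*} [Fintype σ] [DecidableEq σ] [CompleteLinearOrder R] {f : Finset σ → R}
  {c : R}

theorem min_iInf_eq_min_iInf_card_le_half (h_compl : ∀ J, f Jᶜ = f J) (h_empty : c ≤ f ∅) :
    min c (⨅ J, f J) =
      min c (⨅ (J) (_ : 1 ≤ J.card ∧ J.card ≤ Fintype.card σ / 2), f J) := by
  refine le_antisymm (min_le_min le_rfl (le_iInf₂ fun J _ => iInf_le f J))
    (le_min (min_le_left _ _) (le_iInf fun J => ?_))
  have h_card := J.card_compl_add_card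
  rcases J.eq_empty_or_nonempty with rfl | hJ
  · exact (min_le_left _ _).trans h_empty
  rcases Jᶜ.eq_empty_or_nonempty with hJc | hJc
  · exact (min_le_left _ _).trans (h_empty.trans_eq (by rw [← hJc, h_compl]))
  refine (min_le_right _ _).trans ?_
  rcases le_or_gt J.card (Fintype.card σ / 2) with h_le | h_gt
  · exact iInf₂_le J ⟨hJ.card_pos, h_le⟩
  · exact iInf₂_le_of_le Jᶜ ⟨hJc.card_pos, by omega⟩ (h_compl J).le

theorem iInf_eq_iInf_card_le_half (h_compl : ∀ J, f Jᶜ = f J) (h_empty : c ≤ f ∅)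
    (h_le : ∀ J, f J ≤ c) (h_card : 2 ≤ Fintype.card σ) :
    ⨅ J, f J = ⨅ (J) (_ : 1 ≤ J.card ∧ J.card ≤ Fintype.card σ / 2), f J := by
  obtain ⟨j⟩ : Nonempty σ := Fintype.card_pos_iff.1 (by omega)
  have h_single : 1 ≤ ({j} : Finset σ).card ∧ ({j} : Finset σ).card ≤ Fintype.card σ / 2 := by
    rw [Finset.card_singleton]
    omega
  have h_min := min_iInf_eq_min_iInf_card_le_half h_compl h_empty
  rwa [min_eq_right (iInf_le_of_le {j} (h_le _)),
    min_eq_right (iInf₂_le_of_le {j} h_single (h_le _))] at h_min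

end ComplementSymmetry

end LOCCBound

end

open LOCCBound in
theorem theorem1 {Ω : Type*} [MeasurableSpace Ω] {n : ℕ} {I I' : Fin n → Type}
    [∀ j, Countable (I j)] [∀ j, Countable (I' j)]
    (E : Ensemble Ω (∀ j, I j)) (U : Hilb (∀ j, I j) →ₗᵢ[ℂ] Hilb (∀ j, I' j)) :
    -- the general bound, for LOCC and for PPT simulations
    loccFidelity E U ≤ pptFidelity E U ∧
    loccFidelity E U ≤ ⨅ J : Finset (Fin n), minEntropyBound E U J ∧
    pptFidelity E U ≤ ⨅ J : Finset (Fin n), minEntropyBound E U J ∧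
    -- the other expressions for its right-hand side
    (⨅ J : Finset (Fin n), minEntropyBound E U J) =
      (⨅ J : Finset (Fin n), ⨅ (ξ : Op (∀ j, I j)) (_ : IsState ξ),
        dmax (partialTranspose₂ J (Rop E U)) (tensorOne (∀ j, I' j) ξ)) ∧
    (⨅ J : Finset (Fin n), minEntropyBound E U J) =
      (⨅ J : Finset (Fin n), ⨅ (κ : ℝ) (_ : 0 ≤ κ ∧ ∃ ξ : Op (∀ j, I j), IsState ξ ∧
        partialTranspose₂ J (Rop E U) ≤ (κ : ℂ) • tensorOne (∀ j, I' j) ξ), ENNReal.ofReal κ) ∧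
    -- restriction to `1 ≤ |J| ≤ ⌊n/2⌋`: only the trivial values `≥ 1` are lost
    (∀ J : Finset (Fin n), minEntropyBound E U Jᶜ = minEntropyBound E U J) ∧
    1 ≤ minEntropyBound E U ∅ ∧
    min 1 (⨅ J : Finset (Fin n), minEntropyBound E U J) =
      min 1 (⨅ (J : Finset (Fin n)) (_ : 1 ≤ J.card ∧ J.card ≤ n / 2), minEntropyBound E U J) ∧
    -- the simplified bound for ensembles of product states
    (E.IsProduct →
      loccFidelity E U ≤ ⨅ J : Finset (Fin n), productBound E U J ∧
      pptFidelity E U ≤ ⨅ J : Finset (Fin n), productBound E U J ∧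
      (⨅ J : Finset (Fin n), productBound E U J) ≤ 1 ∧
      (∀ J : Finset (Fin n), productBound E U J ≤ 1) ∧
      (∀ J : Finset (Fin n), productBound E U Jᶜ = productBound E U J) ∧
      (2 ≤ n → (⨅ J : Finset (Fin n), productBound E U J) =
        ⨅ (J : Finset (Fin n)) (_ : 1 ≤ J.card ∧ J.card ≤ n / 2), productBound E U J)) := by
  have h_locc := loccFidelity_le_pptFidelity E U
  have h_ppt := le_iInf fun J => pptFidelity_le_minEntropyBound E U J
  have h_compl := minEntropyBound_compl E U
  have h_empty := one_le_minEntropyBound_empty E U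
  refine ⟨h_locc, h_locc.trans h_ppt, h_ppt, iInf_congr fun J => minEntropyBound_eq E U J,
    iInf_congr fun J => (minEntropyBound_eq E U J).trans (iInf_dmax_tensorOne_eq _),
    h_compl, h_empty, ?_, fun hE => ?_⟩
  · simpa only [Fintype.card_fin] using min_iInf_eq_min_iInf_card_le_half h_compl h_empty
  · have h_le (J : Finset (Fin n)) := minEntropyBound_le_productBound U J hE
    have h_le_one (J : Finset (Fin n)) := productBound_le_one U J hE
    refine ⟨h_locc.trans (h_ppt.trans (iInf_mono h_le)), h_ppt.trans (iInf_mono h_le),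
      iInf_le_of_le ∅ (h_le_one ∅), h_le_one, fun J => productBound_compl E U J, fun hn => ?_⟩
    simpa only [Fintype.card_fin] using iInf_eq_iInf_card_le_half
      (fun J => productBound_compl E U J) (h_empty.trans (h_le ∅)) h_le_one
      (hn.trans_eq (Fintype.card_fin n).symm)
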